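/- **Setting.** The linear substitution calculus (LSC) has the terms $t,u,r ::= x \mid \lambda x.t \mid t\,u \mid t[x\backslash u]$, where $\lambda x.t$ and the explicit substitution $t[x\backslash u]$ bind $x$ in $t$; terms are considered modulo $\alpha$-equivalence. Shallow contexts are $C,E ::= \langle\cdot\rangle \mid \lambda x.C \mid C\,t \mid t\,C \mid C[x\backslash t]$ and substitution contexts are $L ::= \langle\cdot\rangle \mid L[x\backslash t]$; $C\langle t\rangle$ denotes plugging. The reduction $\to$ is the closure under shallow contexts $E$ of the rules $$L\langle \lambda x.t\rangle\, u \;\to_{\mathtt{dB}}\; L\langle t[x\backslash u]\rangle,\qquad C\langle x\rangle[x\backslash u]\;\to_{\mathtt{ls}}\; C\langle u\rangle[x\backslash u],$$ where $C$ does not capture $x$ and bound variables are renamed to avoid capture. The $\mathtt{ls}$-step *duplicates* $u$. The position of a $\mathtt{dB}$-redex is the context $E$ around it; the position of an $\mathtt{ls}$-redex is the context around the occurrence of $x$ that is replaced. A (deterministic) *strategy* $\leadsto_X$ selects, for each LSC term, one redex of that term or none (the term is then $\leadsto_X$-normal); $t\leadsto_X u$ means that $u$ is obtained from $t$ by contracting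 the selected redex. For $k\in\mathbb N$ let $\leadsto_X^k(t)$ be the term $u$ with $t\leadsto_X^k u$ if such a term exists, and the $\leadsto_X$-normal form of $t$ otherwise. The size $|t|$ is the number of constructors of $t$, except that an occurrence of the free variable $x_j$ (the free variables being $x_0,x_1,x_2,\dots$) counts $j+1$; on closed terms it is the number of constructors. Algorithms are multi-tape Turing machines; they read and write terms in prefix notation with de Bruijn indices in unary, a number $k$ is given in unary, and a redex of a given term is written as the path to its position. The strategy $\leadsto_X$ is *mechanisable* if 1. *(Subterm)* for every derivation $t\leadsto_X^* u$, if $\leadsto_X$ selects an $\mathtt{ls}$-redex in $u$, then the term duplicated by its contraction is a subterm of $t$ (modulo $\alpha$-equivalence, i.e. up to an injective renaming that fixes the free variables of $t$); 2. *(Selection)* there are a Turing machine and a polynomial $p$ such that on every LSC term $u$ the machine outputs the redex of $u$ selected by $\leadsto_X$, or the information that there is none, in time at most $p(|u|)$. **Theorem (Low-Level Implementation).** Let $\leadsto_X$ be a mechanisable strategy on LSC terms. Then there are a Turing machine and a polynomial $p$ in two variables such that, for all LSC terms $t$ and all $k\in\mathbb N$, the machine on input $(t,k)$ outputs $\leadsto_X^k(t)$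 in time at most $p(k,|t|)$. -/

import Mathlib

namespace LSC

/-! ### Terms

Terms of the linear substitution calculus modulo alpha-equivalence, in de Bruijn notation.
At a place lying under `d` binders, the indices `< d` are bound variables and the index `d + j`
is the free variable `x_j`. -/

inductive Term where
  | var (i : ℕ)
  | lam (t : Term)
  | app (t u : Term)
  /-- `es t u` is the explicit substitution `t[x\u]`: it binds the index `0` in `t`, not in `u`. -/
  | es (t u : Term)
  deriving DecidableEq

/-- A renaming of variables, pushed under one binder. -/
def lift (ρ : ℕ → ℕ) : ℕ → ℕ
  | 0 => 0
  | i + 1 => ρ i + 1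

/-- Capture-avoiding renaming of the free variables of a term. -/
def Term.rename : (ℕ → ℕ) → Term → Term
  | ρ, .var i => .var (ρ i)
  | ρ, .lam t => .lam (t.rename (lift ρ))
  | ρ, .app t u => .app (t.rename ρ) (u.rename ρ)
  | ρ, .es t u => .es (t.rename (lift ρ)) (u.rename ρ)

/-- The same term, seen from under `n` further binders. -/
def Term.shift (n : ℕ) (t : Term) : Term := t.rename (· + n)

/-- The free variables of a term, as indices. -/
def Term.fv : Term → Set ℕ
  | .var i => {i}
  | .lam t => {i | i + 1 ∈ t.fv}
  | .app t u => t.fv ∪ u.fv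
  | .es t u => {i | i + 1 ∈ t.fv} ∪ u.fv

/-- The size of a term lying under `d` binders: one for each constructor, where an occurrence of
the free variable `x_j` (index `d + j`) counts `j + 1`. For an index `i < d`, i.e. a bound variable,
the truncated difference `i - d` is `0`. -/
def Term.sizeUnder : ℕ → Term → ℕ
  | d, .var i => i - d + 1
  | d, .lam t => t.sizeUnder (d + 1) + 1
  | d, .app t u => t.sizeUnder d + u.sizeUnder d + 1
  | d, .es t u => t.sizeUnder (d + 1) + u.sizeUnder d + 1

/-- The size `|t|`. On closed terms it is the number of constructors. -/
def Term.size (t : Term) : ℕ := t.sizeUnder 0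

/-! ### Contexts -/

/-- Shallow contexts: the hole is never inside the content of an explicit substitution. -/
inductive Ctx where
  | hole
  | lam (C : Ctx)
  | appL (C : Ctx) (t : Term)
  | appR (t : Term) (C : Ctx)
  | es (C : Ctx) (t : Term)

/-- Plugging a term into the hole, with capture of its variables. -/
def Ctx.plug : Ctx → Term → Term
  | .hole, s => s
  | .lam C, s => .lam (C.plug s)
  | .appL C t, s => .app (C.plug s) t
  | .appR t C, s => .app t (C.plug s)
  | .es C t, s => .es (C.plug s) t

/-- Plugging a context into the hole of a context. -/
def Ctx.comp : Ctx → Ctx → Ctx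
  | .hole, D => D
  | .lam C, D => .lam (C.comp D)
  | .appL C t, D => .appL (C.comp D) t
  | .appR t C, D => .appR t (C.comp D)
  | .es C t, D => .es (C.comp D) t

/-- The number of binders above the hole. -/
def Ctx.depth : Ctx → ℕ
  | .hole => 0
  | .lam C => C.depth + 1
  | .appL C _ => C.depth
  | .appR _ C => C.depth
  | .es C _ => C.depth + 1

/-- Substitution contexts `L ::= ⟨·⟩ | L[x\t]`. -/
inductive SubstCtx where
  | hole
  | es (L : SubstCtx) (t : Term)

def SubstCtx.toCtx : SubstCtx → Ctx
  | .hole => .hole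
  | .es L t => .es L.toCtx t

/-! ### Redexes and reduction -/

/-- The redexes of the calculus, each with its external (shallow) context `E`:
* `dB E L t u` is `E⟨L⟨λx.t⟩ u⟩ → E⟨L⟨t[x\u]⟩⟩`;
* `ls E C u` is `E⟨C⟨x⟩[x\u]⟩ → E⟨C⟨u⟩[x\u]⟩`. -/
inductive Redex where
  | dB (E : Ctx) (L : SubstCtx) (t u : Term)
  | ls (E C : Ctx) (u : Term)

/-- The term that contains the redex. In `C⟨x⟩[x\u]` the substituted occurrence of `x` has, under
the binders of `C`, the index `C.depth`. -/
def Redex.source : Redex → Term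
  | .dB E L t u => E.plug (.app (L.toCtx.plug (.lam t)) u)
  | .ls E C u => E.plug (.es (C.plug (.var C.depth)) u)

/-- The term obtained by contracting the redex. -/
def Redex.target : Redex → Term
  | .dB E L t u => E.plug (L.toCtx.plug (.es t (u.shift L.toCtx.depth)))
  | .ls E C u => E.plug (.es (C.plug (u.shift (C.depth + 1))) u)

/-- The position of a redex: the context around the changing expression for a `dB`-redex, the
context around the variable occurrence to substitute for an `ls`-redex. -/
def Redex.position : Redex → Ctx
  | .dB E _ _ _ => E
  | .ls E C u => E.comp (.es C u)

/-- A (deterministic) strategy: it selects a redex of each term, or none, in which case the term is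
normal for the strategy. -/
structure Strategy where
  next : Term → Option Redex
  source_next : ∀ (t : Term) (R : Redex), next t = some R → R.source = t

/-- One step of the strategy. -/
def Strategy.Step (X : Strategy) (t u : Term) : Prop :=
  ∃ R, X.next t = some R ∧ R.target = u

/-- The term reached from `t` after `k` steps of the strategy, or the normal form of `t` for the
strategy if it is reached in fewer than `k` steps. -/
def Strategy.after (X : Strategy) : ℕ → Term → Term
  | 0, t => t
  | k + 1, t =>
    match X.next t with
    | none => t
    | some R => X.after k R.target

/-! ### Subterms -/

/-- `SubtermUnder e s t`: an occurrence of `s` as a subterm of `t` (possibly inside an explicit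
substitution), under `e` binders of `t`. -/
inductive SubtermUnder : ℕ → Term → Term → Prop
  | refl (t : Term) : SubtermUnder 0 t t
  | lam {e : ℕ} {s t : Term} : SubtermUnder e s t → SubtermUnder (e + 1) s (.lam t)
  | appL {e : ℕ} {s t : Term} (u : Term) : SubtermUnder e s t → SubtermUnder e s (.app t u)
  | appR {e : ℕ} {s u : Term} (t : Term) : SubtermUnder e s u → SubtermUnder e s (.app t u)
  | esL {e : ℕ} {s t : Term} (u : Term) : SubtermUnder e s t → SubtermUnder (e + 1) s (.es t u)
  | esR {e : ℕ} {s u : Term} (t : Term) : SubtermUnder e s u → SubtermUnder e s (.es t u)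

/-- The term `r`, occurring under `d` binders (of some term), is a subterm of `t` modulo
alpha-equivalence of `t`: up to an injective renaming of the variables of the subterm that fixes the
free variables of `t`, which have the indices `e + j` at the subterm of `t` and `d + j` at `r`. -/
def IsSubterm (d : ℕ) (r t : Term) : Prop :=
  ∃ (e : ℕ) (s : Term) (ρ : ℕ → ℕ), SubtermUnder e s t ∧ Set.InjOn ρ s.fv ∧
    (∀ j, e + j ∈ s.fv → ρ (e + j) = d + j) ∧ r = s.rename ρ

/-! ### Encodings and machines -/

/-- The symbols with which terms and (in unary) natural numbers are written. -/
inductive Sym where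
  | tick
  | succ
  | var
  | lam
  | app
  | es
  deriving DecidableEq

/-- Terms as strings: prefix notation, with the indices in unary. -/
def Term.code : Term → List Sym
  | .var i => List.replicate i .succ ++ [.var]
  | .lam t => .lam :: t.code
  | .app t u => .app :: (t.code ++ u.code)
  | .es t u => .es :: (t.code ++ u.code)

/-- The input `(t, k)`: the number `k` in unary, followed by the term `t`. -/
def inputCode (t : Term) (k : ℕ) : List Sym := List.replicate k .tick ++ t.code

inductive Dir where
  | lam
  | appL
  | appR
  | es
  deriving DecidableEq

/-- The path from the root to the hole. -/
def Ctx.path : Ctx → List Dir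
  | .hole => []
  | .lam C => .lam :: C.path
  | .appL C _ => .appL :: C.path
  | .appR _ C => .appR :: C.path
  | .es C _ => .es :: C.path

/-- The answer to the search for a redex in a given term: the path to the position of the redex
(which determines the redex), or the one-letter word `none` if there is no redex to reduce. -/
def answerCode : Option Redex → List (Option Dir)
  | none => [none]
  | some R => R.position.path.map some

/-- The (multi-tape) Turing machine `M` started on the word `x` halts with output `y` after at most
`n` steps. -/
def OutputsInTime {A B : Type} (M : Turing.TM2ComputableAux A B) (x : List A) (y : List B)
    (n : ℕ) : Prop :=
  Nonempty (Turing.TM2OutputsInTime M.tm (x.map M.inputAlphabet.symm)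
    (some (y.map M.outputAlphabet.symm)) n)

/-! ### Mechanisable strategies -/

/-- Subterm property: along every derivation of the strategy from a term `t`, the terms duplicated
(by the `ls`-steps) are subterms of `t`. -/
def Strategy.SubtermProperty (X : Strategy) : Prop :=
  ∀ (t u : Term) (E C : Ctx) (r : Term), Relation.ReflTransGen X.Step t u →
    X.next u = some (.ls E C r) → IsSubterm E.depth r t

/-- Selection property: the search for the next redex to reduce in a term `u` takes time polynomial
in `|u|`. (Every term is reached by an empty derivation.) -/
def Strategy.SelectionProperty (X : Strategy) : Prop :=
  ∃ (M : Turing.TM2ComputableAux Sym (Option Dir)) (p : Polynomial ℕ),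
    ∀ u : Term, OutputsInTime M u.code (answerCode (X.next u)) (p.eval u.size)

structure Strategy.Mechanisable (X : Strategy) : Prop where
  subterm : X.SubtermProperty
  selection : X.SelectionProperty

end LSC

/-! ### A language of program fragments for multi-stack machines. -/

namespace LSC

open Turing Function

/-! The machine alternates two actions at most `k` times: it calls the selection machine on the
current term, and it contracts the redex found. Both are polynomial in the size of the current term,
so everything rests on keeping that term small.

Two invariants do this. A `dB`-step loses a constructor and an `ls`-step adds at most the number of
constructors of the duplicated term, which by the subterm property is at most that of the initial
term `t`; so the number of constructors grows linearly in the number of steps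
(`Strategy.SubtermProperty.nodes_after_le`). Moreover reduction creates no free variables
(`Redex.below_target`), so the free indices stay below `|t|`. Together they bound both the written
length, including unary indices (`Term.Below.length_code_le`), and the size on which selection time
depends (`Term.Below.sizeUnder_le`).

Contraction takes time quadratic in the lengths of the terms before and after it (`runs_contract`).
In prefix notation the position splits the string into a prefix, a subterm and a suffix, and a step
rearranges substrings, edits a few symbols and shifts one term. The work is to parse terms with a
stack instead of recursion (`runs_transferLoop`) and to count the binders between a substitution and
the place where its content goes (`runs_ascend`). Selection is a black-box call (`runs_call`), and
`runs_loop` multiplies the uniform cost of one round by the number of rounds. -/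

instance : Fintype Sym :=
  ⟨{.tick, .succ, .var, .lam, .app, .es}, by intro x; cases x <;> decide⟩

/-- The stacks of the implementation, besides those of the selection machine. -/
inductive Stk where
  | inp | out | tmp | arg | hold | amt | sav | dep | aux | todo | path | rpath | lvl | passed | cnt
  deriving DecidableEq

instance : Fintype Stk :=
  ⟨{.inp, .out, .tmp, .arg, .hold, .amt, .sav, .dep, .aux, .todo, .path, .rpath, .lvl, .passed,
    .cnt}, by intro x; cases x <;> decide⟩

/-- The stack alphabets of a machine that extends `tm` with the stacks `Stk`. -/
abbrev Alph (tm : FinTM2) : Stk ⊕ tm.K → Type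
  | .inl _ => Sym
  | .inr k => tm.Γ k

/-- The internal states: a one-symbol register and a state of `tm`. -/
abbrev Reg (tm : FinTM2) : Type := Option Sym × tm.σ

/-- The contents of all stacks. -/
structure Store (tm : FinTM2) where
  inp : List Sym
  out : List Sym
  tmp : List Sym
  arg : List Sym
  hold : List Sym
  amt : List Sym
  sav : List Sym
  dep : List Sym
  aux : List Sym
  todo : List Sym
  path : List Sym
  rpath : List Sym
  lvl : List Sym
  passed : List Sym
  cnt : List Sym
  ext : ∀ k, List (tm.Γ k)

namespace Store

variable {tm : FinTM2}

def get (s : Store tm) : Stk → List Sym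
  | .inp => s.inp
  | .out => s.out
  | .tmp => s.tmp
  | .arg => s.arg
  | .hold => s.hold
  | .amt => s.amt
  | .sav => s.sav
  | .dep => s.dep
  | .aux => s.aux
  | .todo => s.todo
  | .path => s.path
  | .rpath => s.rpath
  | .lvl => s.lvl
  | .passed => s.passed
  | .cnt => s.cnt

def set (s : Store tm) (q : Stk) (x : List Sym) : Store tm :=
  match q with
  | .inp => { s with inp := x }
  | .out => { s with out := x }
  | .tmp => { s with tmp := x }
  | .arg => { s with arg := x }
  | .hold => { s with hold := x }
  | .amt => { s with amt := x }
  | .sav => { s with sav := x }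
  | .dep => { s with dep := x }
  | .aux => { s with aux := x }
  | .todo => { s with todo := x }
  | .path => { s with path := x }
  | .rpath => { s with rpath := x }
  | .lvl => { s with lvl := x }
  | .passed => { s with passed := x }
  | .cnt => { s with cnt := x }

@[simp] theorem get_set (s : Store tm) (q : Stk) (x : List Sym) : (s.set q x).get q = x := by
  cases q <;> rfl

theorem get_set_of_ne (s : Store tm) {q r : Stk} (h : r ≠ q) (x : List Sym) :
    (s.set q x).get r = s.get r := by
  cases q <;> cases r <;> first | rfl | exact absurd rfl h

@[simp] theorem set_set (s : Store tm) (q : Stk) (x y : List Sym) :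
    (s.set q x).set q y = s.set q y := by
  cases q <;> rfl

theorem set_comm (s : Store tm) {q r : Stk} (h : r ≠ q) (x y : List Sym) :
    (s.set q x).set r y = (s.set r y).set q x := by
  cases q <;> cases r <;> first | rfl | exact absurd rfl h

@[simp] theorem set_get (s : Store tm) (q : Stk) : s.set q (s.get q) = s := by
  cases q <;> rfl

@[simp] theorem ext_set (s : Store tm) (q : Stk) (x : List Sym) : (s.set q x).ext = s.ext := by
  cases q <;> rfl

/-- The store as a family of stacks. -/
def stk (s : Store tm) : ∀ k, List (Alph tm k)
  | .inl q => s.get q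
  | .inr k => s.ext k

theorem update_inl (s : Store tm) (q : Stk) (x : List Sym) :
    update s.stk (.inl q) x = (s.set q x).stk := by
  funext k
  rcases k with r | k
  · by_cases h : r = q
    · subst h
      simp [stk]
    · rw [update_of_ne (by simpa using h)]
      exact (s.get_set_of_ne h x).symm
  · rw [update_of_ne (by simp)]
    simp [stk]

theorem update_inr (s : Store tm) (k : tm.K) (x : List (tm.Γ k)) :
    update s.stk (.inr k) x = ({ s with ext := update s.ext k x } : Store tm).stk := by
  funext j
  rcases j with r | j
  · rw [update_of_ne (by simp)]
    cases r <;> rfl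
  · by_cases h : j = k
    · subst h
      simp [stk]
    · rw [update_of_ne (by simpa using h)]
      simp [stk, h]

end Store

/-- A program fragment over the stacks of `tm` and those of `Stk`. -/
structure Frag (tm : FinTM2) where
  Label : Type
  [fin : Fintype Label]
  main : Label
  code : Label → TM2.Stmt (Alph tm) Label (Reg tm)

/-- `n` steps of a machine. -/
def Steps {α : Type} (f : α → Option α) (n : ℕ) (a b : α) : Prop :=
  (flip bind f)^[n] (some a) = some b

theorem Steps.trans {α : Type} {f : α → Option α} {m n : ℕ} {a b c : α} (h : Steps f m a b)
    (h' : Steps f n b c) : Steps f (m + n) a c := by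
  unfold Steps at *
  rw [Nat.add_comm, iterate_add_apply, h, h']

theorem Steps.single {α : Type} {f : α → Option α} {a b : α} (h : f a = some b) :
    Steps f 1 a b := h

theorem Steps.cases_succ {α : Type} {f : α → Option α} {n : ℕ} {a b : α}
    (h : Steps f (n + 1) a b) : ∃ c, f a = some c ∧ Steps f n c b := by
  unfold Steps at *
  rw [iterate_succ_apply] at h
  change (flip bind f)^[n] (f a) = _ at h
  cases hc : f a with
  | none =>
    -- `none` is absorbing, so a run that still reaches a configuration cannot have passed through
    -- it.
    rw [hc, iterate_fixed (f := flip bind f) (x := none) rfl] at h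
    simp at h
  | some c => exact ⟨c, rfl, hc ▸ h⟩

/-- Rename the labels of a statement, and continue at `next` instead of halting. -/
def relabel {K : Type} {Γ : K → Type} {Λ Λ' σ : Type} (e : Λ → Λ') (next : Option Λ') :
    TM2.Stmt Γ Λ σ → TM2.Stmt Γ Λ' σ
  | .push k f q => .push k f (relabel e next q)
  | .peek k f q => .peek k f (relabel e next q)
  | .pop k f q => .pop k f (relabel e next q)
  | .load f q => .load f (relabel e next q)
  | .branch f q r => .branch f (relabel e next q) (relabel e next r)
  | .goto f => .goto fun v => e (f v)
  | .halt => next.elim .halt fun l => .goto fun _ => l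

def relabelCfg {K : Type} {Γ : K → Type} {Λ Λ' σ : Type} (e : Λ → Λ') (next : Option Λ')
    (c : TM2.Cfg Γ Λ σ) : TM2.Cfg Γ Λ' σ :=
  ⟨c.l.elim next fun l => some (e l), c.var, c.stk⟩

/-- A halt turned into a jump still ends the same machine step, so linking fragments costs no time
and the simulation is step for step. -/
theorem stepAux_relabel {K : Type} [DecidableEq K] {Γ : K → Type} {Λ Λ' σ : Type} (e : Λ → Λ')
    (next : Option Λ') (q : TM2.Stmt Γ Λ σ) (v : σ) (S : ∀ k, List (Γ k)) :
    TM2.stepAux (relabel e next q) v S = relabelCfg e next (TM2.stepAux q v S) := by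
  induction q generalizing v S with
  | branch f q r ihq ihr =>
    simp only [relabel, TM2.stepAux]
    cases f v <;> simp [ihq, ihr]
  | halt => cases next <;> rfl
  | goto => rfl
  | _ => simp_all [relabel]

theorem Steps.relabel {K : Type} [DecidableEq K] {Γ : K → Type} {Λ Λ' σ : Type} {e : Λ → Λ'}
    {next : Option Λ'} {m : Λ → TM2.Stmt Γ Λ σ} {m' : Λ' → TM2.Stmt Γ Λ' σ}
    (hm : ∀ l, m' (e l) = LSC.relabel e next (m l)) {n : ℕ} {c d : TM2.Cfg Γ Λ σ}
    (h : Steps (TM2.step m) n c d) (hd : d.l = none) (hc : c.l ≠ none) :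
    Steps (TM2.step m') n (relabelCfg e next c) (relabelCfg e next d) := by
  induction n generalizing c with
  | zero =>
    cases h
    exact absurd hd hc
  | succ n ih =>
    obtain ⟨b, hb, hs⟩ := h.cases_succ
    obtain ⟨_ | l, v, S⟩ := c
    · exact absurd rfl hc
    have hb' : TM2.step m' (relabelCfg e next ⟨some l, v, S⟩) = some (relabelCfg e next b) := by
      cases hb
      change some (TM2.stepAux (m' (e l)) v S) = _
      rw [hm, stepAux_relabel]
    rw [Nat.add_comm]
    refine (Steps.single hb').trans ?_
    -- A halted `b` has no successor in the original machine, although its image may continue at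
    -- `next`; hence no steps may remain in that case.
    by_cases hbl : b.l = none
    · cases n with
      | zero =>
        obtain rfl : b = d := Option.some.inj hs
        rfl
      | succ n =>
        obtain ⟨a, ha, -⟩ := hs.cases_succ
        obtain ⟨_, w, T⟩ := b
        cases hbl
        exact absurd ha (by simp)
    · exact ih hs hbl

/-! ### Timed execution of fragments and of their combinations. -/

section

variable {tm : FinTM2}

/-- The fragment takes the stacks from `s` to `s'` in at most `n` steps, for every content of the
register, and keeps `tm` in its initial state. -/
def Runs (F : Frag tm) (s : Store tm) (n : ℕ) (s' : Store tm) : Prop :=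
  ∀ v : Option Sym, ∃ (v' : Option Sym) (m : ℕ), m ≤ n ∧
    Steps (TM2.step F.code) m ⟨some F.main, (v, tm.initialState), s.stk⟩
      ⟨none, (v', tm.initialState), s'.stk⟩

theorem Runs.mono {F : Frag tm} {s s' : Store tm} {m n : ℕ} (h : Runs F s m s') (hmn : m ≤ n) :
    Runs F s n s' := fun v =>
  let ⟨v', k, hk, h⟩ := h v
  ⟨v', k, hk.trans hmn, h⟩

namespace Frag

def ofStmt (q : TM2.Stmt (Alph tm) Unit (Reg tm)) : Frag tm := ⟨Unit, (), fun _ => q⟩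

def push (q : Stk) (a : Sym) : Frag tm := ofStmt (.push (.inl q) (fun _ => a) .halt)

def pop (q : Stk) : Frag tm := ofStmt (.pop (.inl q) (fun v _ => v) .halt)

/-- Move the top symbol of `a` to `b`. -/
def move (a b : Stk) : Frag tm :=
  -- The default symbol only makes the statement total: `runs_move` assumes that the source stack is
  -- nonempty.
  ofStmt (.pop (.inl a) (fun v x => (x, v.2)) (.push (.inl b) (fun v => v.1.getD .tick) .halt))

def seq (F G : Frag tm) : Frag tm :=
  letI := F.fin
  letI := G.fin
  { Label := F.Label ⊕ G.Label
    main := .inl F.main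
    code := Sum.elim (fun l => relabel Sum.inl (some (.inr G.main)) (F.code l))
      fun l => relabel Sum.inr none (G.code l) }

infixr:60 " ;; " => Frag.seq

/-- Choose a fragment according to the top symbol of `q`. -/
def onTop (q : Stk) (F : Option Sym → Frag tm) : Frag tm :=
  letI := fun o => (F o).fin
  { Label := Option (Σ o, (F o).Label)
    main := none
    code := fun l => l.elim (.peek (.inl q) (fun v x => (x, v.2))
        (.goto fun v => some ⟨v.1, (F v.1).main⟩))
      fun l => relabel (fun i => some ⟨l.1, i⟩) none ((F l.1).code l.2) }

/-- Repeat a fragment while the top of the stack `k` satisfies `c`. -/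
def whileTop (k : Stk ⊕ tm.K) (c : Option (Alph tm k) → Bool) (F : Frag tm) : Frag tm :=
  letI := F.fin
  { Label := Option F.Label
    main := none
    -- The register serves as a Boolean here: `some .tick` means that the test succeeded.
    code := fun l => l.elim (.peek k (fun v x => (bif c x then some .tick else none, v.2))
        (.branch (fun v => v.1.isSome) (.goto fun _ => some F.main) .halt))
      fun l => relabel some (some none) (F.code l) }

end Frag

open Frag

theorem runs_push (s : Store tm) (q : Stk) (a : Sym) :
    Runs (push q a) s 1 (s.set q (a :: s.get q)) := fun v =>
  ⟨v, 1, le_rfl, Steps.single (by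
    rw [← Store.update_inl]
    rfl)⟩

theorem runs_pop (s : Store tm) (q : Stk) : Runs (pop q) s 1 (s.set q (s.get q).tail) := fun v =>
  ⟨v, 1, le_rfl, Steps.single (by
    rw [← Store.update_inl]
    rfl)⟩

theorem runs_move {s : Store tm} {a b : Stk} {x : Sym} {l : List Sym} (h : s.get a = x :: l) :
    Runs (move a b) s 1 ((s.set a l).set b (x :: (s.set a l).get b)) := fun v =>
  ⟨some x, 1, le_rfl, Steps.single (by
    rw [← Store.update_inl]
    have hx : s.stk (.inl a) = x :: l := h
    simp only [Frag.move, ofStmt, TM2.step, TM2.stepAux]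
    rw [hx]
    simp only [List.head?_cons, List.tail_cons, Store.update_inl, Option.getD_some]
    rfl)⟩

theorem Runs.seq {F G : Frag tm} {s s' s'' : Store tm} {m n : ℕ} (h : Runs F s m s')
    (h' : Runs G s' n s'') : Runs (F ;; G) s (m + n) s'' := by
  intro v
  obtain ⟨v', i, hi, h⟩ := h v
  obtain ⟨v'', j, hj, h'⟩ := h' v'
  refine ⟨v'', i + j, by omega, ?_⟩
  exact (h.relabel (m' := (F ;; G).code) (e := Sum.inl) (next := some (.inr G.main))
    (fun _ => rfl) rfl (by simp)).trans
      (h'.relabel (m' := (F ;; G).code) (e := Sum.inr) (next := none) (fun _ => rfl) rfl (by simp))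

theorem runs_onTop {s s' : Store tm} {q : Stk} {F : Option Sym → Frag tm} {n : ℕ}
    (h : Runs (F (s.get q).head?) s n s') : Runs (onTop q F) s (n + 1) s' := by
  intro v
  obtain ⟨v', m, hm, h⟩ := h (s.get q).head?
  refine ⟨v', 1 + m, by omega, ?_⟩
  have h1 : Steps (TM2.step (onTop q F).code) 1 ⟨some none, (v, tm.initialState), s.stk⟩
      ⟨some (some ⟨(s.get q).head?, (F (s.get q).head?).main⟩),
        ((s.get q).head?, tm.initialState), s.stk⟩ := Steps.single rfl
  exact h1.trans (h.relabel (m' := (onTop q F).code)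
    (e := fun i => some (⟨(s.get q).head?, i⟩ : Σ o, (F o).Label)) (next := none) (fun _ => rfl)
    rfl (by simp))

theorem runs_whileTop_false {s : Store tm} {k : Stk ⊕ tm.K} {c : Option (Alph tm k) → Bool}
    {F : Frag tm} (h : c (s.stk k).head? = false) : Runs (whileTop k c F) s 1 s := fun v =>
  ⟨none, 1, le_rfl, Steps.single (by
    change some (TM2.stepAux _ _ _) = _
    simp [whileTop, h])⟩

theorem runs_whileTop_true {s s' s'' : Store tm} {k : Stk ⊕ tm.K} {c : Option (Alph tm k) → Bool}
    {F : Frag tm} {m n : ℕ} (h : c (s.stk k).head? = true) (hF : Runs F s m s')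
    (hW : Runs (whileTop k c F) s' n s'') : Runs (whileTop k c F) s (m + n + 1) s'' := by
  intro v
  obtain ⟨v', i, hi, hF⟩ := hF (some .tick)
  obtain ⟨v'', j, hj, hW⟩ := hW v'
  refine ⟨v'', 1 + (i + j), by omega, ?_⟩
  have h1 : Steps (TM2.step (whileTop k c F).code) 1 ⟨some none, (v, tm.initialState), s.stk⟩
      ⟨some (some F.main), (some .tick, tm.initialState), s.stk⟩ := Steps.single (by
    change some (TM2.stepAux _ _ _) = _
    simp [whileTop, h])
  exact h1.trans ((hF.relabel (m' := (whileTop k c F).code) (e := some) (next := some none)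
    (fun _ => rfl) rfl (by simp)).trans hW)

end

end LSC

namespace LSC

open Turing Function Frag

variable {tm : FinTM2}

theorem Runs.to {F : Frag tm} {s s' t : Store tm} {m n : ℕ} (h : Runs F s m s') (hs : s' = t)
    (hmn : m ≤ n) : Runs F s n t :=
  hs ▸ h.mono hmn

theorem Runs.to_left {F : Frag tm} {s s' t : Store tm} {n : ℕ} (h : Runs F s n s') (hs : t = s) :
    Runs F t n s' :=
  hs ▸ h

/-! ### Moving and erasing stacks -/

namespace Frag

def skip : Frag tm := ofStmt .halt

def whileNonempty (q : Stk) (F : Frag tm) : Frag tm :=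
  whileTop (.inl q) (fun o => o.isSome) F

def clear (q : Stk) : Frag tm := whileNonempty q (pop q)

/-- Move the stack `a`, symbol by symbol, to `b`. -/
def moveAll (a b : Stk) : Frag tm := whileNonempty a (move a b)

end Frag

theorem runs_skip (s : Store tm) : Runs skip s 1 s := fun v => ⟨v, 1, le_rfl, Steps.single rfl⟩

theorem runs_whileNonempty_nil {s : Store tm} {q : Stk} {F : Frag tm} (h : s.get q = []) :
    Runs (whileNonempty q F) s 1 s :=
  runs_whileTop_false (by
    change (s.get q).head?.isSome = false
    simp [h])

theorem runs_whileNonempty_cons {s s' s'' : Store tm} {q : Stk} {F : Frag tm} {m n : ℕ} {x : Sym}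
    {l : List Sym} (h : s.get q = x :: l) (hF : Runs F s m s')
    (hW : Runs (whileNonempty q F) s' n s'') : Runs (whileNonempty q F) s (m + n + 1) s'' :=
  runs_whileTop_true (by
    change (s.get q).head?.isSome = true
    simp [h]) hF hW

theorem runs_clear (s : Store tm) (q : Stk) :
    Runs (clear q) s (2 * (s.get q).length + 1) (s.set q []) := by
  generalize hl : s.get q = l
  induction l generalizing s with
  | nil => exact (runs_whileNonempty_nil hl).to (by rw [← hl, Store.set_get]) (by simp)
  | cons x l ih =>
    refine (runs_whileNonempty_cons hl (runs_pop s q) (ih (s.set q (s.get q).tail) ?_)).to ?_ ?_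
    · simp [hl]
    · simp
    · simp; omega

/-- Popping and pushing reverses the string, so text that must keep its orientation is moved twice.
The stacks must differ for the loop to make progress. -/
theorem runs_moveAll (s : Store tm) {a b : Stk} (hab : b ≠ a) :
    Runs (moveAll a b) s (2 * (s.get a).length + 1)
      ((s.set a []).set b ((s.get a).reverse ++ s.get b)) := by
  generalize hl : s.get a = l
  induction l generalizing s with
  | nil =>
    refine (runs_whileNonempty_nil hl).to ?_ (by simp)
    rw [← hl, Store.set_get]
    simp [hl]
  | cons x l ih =>
    refine (runs_whileNonempty_cons hl (runs_move hl) (ih _ ?_)).to ?_ ?_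
    · rw [Store.get_set_of_ne _ hab.symm, Store.get_set]
    · rw [Store.set_comm _ hab.symm, Store.set_set, Store.set_set, Store.get_set,
        Store.get_set_of_ne _ hab]
      simp
    · simp; omega

/-- Move the stack `out` to both `inp` and `arg`. -/
def Frag.duplicate : Frag tm :=
  whileNonempty .out (onTop .out fun o => pop .out ;; push .inp (o.getD .tick) ;;
    push .arg (o.getD .tick))

theorem runs_duplicate (s : Store tm) :
    Runs duplicate s (6 * s.out.length + 1)
      { s with out := [], inp := s.out.reverse ++ s.inp, arg := s.out.reverse ++ s.arg } := by
  generalize hl : s.out = l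
  induction l generalizing s with
  | nil =>
    obtain ⟨⟩ := s
    cases hl
    exact (runs_whileNonempty_nil rfl).to rfl (by simp)
  | cons x l ih =>
    obtain ⟨⟩ := s
    cases hl
    refine (runs_whileNonempty_cons rfl (runs_onTop ((runs_pop _ _).seq
      ((runs_push _ _ _).seq (runs_push _ _ _)))) (ih _ rfl)).to ?_ ?_
    · simp [Store.set, Store.get]
    · simp; omega

/-! ### Transferring a term -/

/-- The result of applying `Term.rename` to the shift by `n` under `d` binders. -/
def Term.shiftUnder (d n : ℕ) (t : Term) : Term := t.rename fun i => if i < d then i else i + n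

/-- Passing a binder only raises the cutoff by one. Thus the renaming in force is described by two
numbers, which the machine can keep as the stacks `dep` and `amt`. -/
theorem lift_shiftUnder (d n : ℕ) : lift (fun i => if i < d then i else i + n) =
    fun i => if i < d + 1 then i else i + n := by
  funext i
  cases i with
  | zero => simp [lift]
  | succ i =>
    simp only [lift, Nat.add_lt_add_iff_right]
    split <;> omega

@[simp] theorem Term.shiftUnder_var (d n i : ℕ) :
    (Term.var i).shiftUnder d n = .var (if i < d then i else i + n) := rfl

@[simp] theorem Term.shiftUnder_lam (d n : ℕ) (t : Term) :
    (Term.lam t).shiftUnder d n = .lam (t.shiftUnder (d + 1) n) := by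
  simp [shiftUnder, rename, lift_shiftUnder]

@[simp] theorem Term.shiftUnder_app (d n : ℕ) (t u : Term) :
    (Term.app t u).shiftUnder d n = .app (t.shiftUnder d n) (u.shiftUnder d n) := rfl

@[simp] theorem Term.shiftUnder_es (d n : ℕ) (t u : Term) :
    (Term.es t u).shiftUnder d n = .es (t.shiftUnder (d + 1) n) (u.shiftUnder d n) := by
  simp [shiftUnder, rename, lift_shiftUnder]

theorem Term.shiftUnder_zero_left (n : ℕ) (t : Term) : t.shiftUnder 0 n = t.shift n := by
  simp [shiftUnder, shift]

@[simp] theorem Term.shiftUnder_zero_right (d : ℕ) (t : Term) : t.shiftUnder d 0 = t := by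
  induction t generalizing d <;> simp_all

namespace Frag

/-- Transfer an index in unary from `inp` to `out`, moving a tick from `dep` to `aux` for each
unit. -/
def transferIndex : Frag tm :=
  whileTop (.inl .inp) (fun o => o == some .succ)
    (move .inp .out ;; onTop .dep fun o => bif o.isSome then move .dep .aux else skip)

/-- Add the number on the stack `amt` to the index on `out`. -/
def addAmount : Frag tm :=
  whileNonempty .amt (move .amt .sav ;; push .out .succ) ;; moveAll .sav .amt

def transferVar : Frag tm :=
  transferIndex ;; (onTop .dep fun o => bif o.isSome then skip else addAmount) ;;
    move .inp .out ;; moveAll .aux .dep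

def transferStep : Frag tm :=
  onTop .todo fun o =>
    match o with
    | some .lam => pop .todo ;; pop .dep
    | _ => onTop .inp fun a =>
      match a with
      | some .lam => move .inp .out ;; pop .todo ;; push .todo .lam ;; push .todo .var ;;
          push .dep .tick
      | some .es => move .inp .out ;; push .todo .lam ;; push .todo .var ;; push .dep .tick
      | some .app => move .inp .out ;; push .todo .var
      | _ => pop .todo ;; transferVar

/-- Work off the stack `todo`, on which `var` stands for a term to be transferred from `inp` to
`out`, and `lam` for a binder to be left. -/
def transferLoop : Frag tm := whileNonempty .todo transferStep

/-- Transfer a term from `inp` to `out`, shifting its free variables by the number on `amt`. -/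
def transfer : Frag tm := push .todo .var ;; transferLoop

end Frag

/-- Cancelling a tick of `dep` per unit of the index compares the two numbers: ticks survive exactly
when `i < d`, i.e. when the variable is bound. The cancelled ticks wait on `aux` so that `dep` can
be restored. -/
theorem runs_transferIndex (i d a : ℕ) (s : Store tm) (rest : List Sym)
    (h : s.inp = List.replicate i .succ ++ .var :: rest) (hd : s.dep = List.replicate d .tick)
    (ha : s.aux = List.replicate a .tick) :
    Runs transferIndex s (4 * i + 1)
      { s with inp := .var :: rest
               out := List.replicate i .succ ++ s.out
               dep := List.replicate (d - i) .tick
               aux := List.replicate (min i d + a) .tick } := by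
  induction i generalizing s d a with
  | zero =>
    refine (runs_whileTop_false ?_).to ?_ (by simp)
    · change (s.inp.head? == some Sym.succ) = false
      simp [h]
    · obtain ⟨⟩ := s
      simp_all
  | succ i ih =>
    obtain ⟨⟩ := s
    cases h
    cases hd
    cases ha
    cases d with
    | zero =>
      refine (runs_whileTop_true rfl ((runs_move rfl).seq (runs_onTop (runs_skip _)))
        (ih 0 a _ rfl rfl rfl)).to ?_ (by omega)
      simp [Store.set, Store.get, List.replicate_succ']
    | succ d =>
      refine (runs_whileTop_true rfl ((runs_move rfl).seq (runs_onTop (runs_move rfl)))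
        (ih d (a + 1) _ rfl rfl rfl)).to ?_ (by omega)
      simp [Store.set, Store.get, List.replicate_succ', Nat.add_min_add_right]
      omega

theorem runs_addAmount (n : ℕ) (s : Store tm) (hn : s.amt = List.replicate n .tick)
    (hs : s.sav = []) :
    Runs addAmount s (5 * n + 2) { s with out := List.replicate n .succ ++ s.out } := by
  -- The induction must allow ticks already saved on `sav`; these later refill `amt` for the next
  -- variable.
  have key : ∀ (n m : ℕ) (s : Store tm), s.amt = List.replicate n .tick →
      s.sav = List.replicate m .tick →
      Runs (whileNonempty .amt (move .amt .sav ;; push .out .succ)) s (3 * n + 1)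
        { s with out := List.replicate n .succ ++ s.out, amt := [],
                 sav := List.replicate (n + m) .tick } := by
    intro n
    induction n with
    | zero =>
      intro m s hn hs
      obtain ⟨⟩ := s
      cases hn
      cases hs
      exact (runs_whileNonempty_nil rfl).to (by simp) (by simp)
    | succ n ih =>
      intro m s hn hs
      obtain ⟨⟩ := s
      cases hn
      cases hs
      refine (runs_whileNonempty_cons rfl ((runs_move rfl).seq (runs_push _ _ _))
        (ih (m + 1) _ rfl rfl)).to ?_ (by omega)
      simp [Store.set, Store.get, List.replicate_succ']
      omega
  refine ((key n 0 s hn hs).seq (runs_moveAll _ (by decide))).to ?_ ?_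
  · obtain ⟨⟩ := s
    cases hn
    cases hs
    simp [Store.set, Store.get]
  · simp [Store.get]
    omega

theorem runs_transferVar (i d n : ℕ) (s : Store tm) (rest : List Sym)
    (h : s.inp = (Term.var i).code ++ rest) (hd : s.dep = List.replicate d .tick)
    (hn : s.amt = List.replicate n .tick) (ha : s.aux = []) (hs : s.sav = []) :
    Runs transferVar s (20 * (n + 1) * (i + 1))
      { s with inp := rest, out := ((Term.var i).shiftUnder d n).code.reverse ++ s.out } := by
  have h1 := runs_transferIndex i d 0 s rest (by simp [h, Term.code]) hd ha
  have hmul : 20 * (n + 1) * (i + 1) = 20 * (n * i) + 20 * n + 20 * i + 20 := by ring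
  have hmin : min i d ≤ i := min_le_left _ _
  -- The machine's test for a bound variable: is a tick left on `dep`?
  have h2 : (List.replicate (d - i) Sym.tick).head?.isSome = decide (i < d) := by
    by_cases hid : i < d <;> simp [List.head?_replicate, hid] <;> omega
  have h3 : Runs (onTop .dep fun o => bif o.isSome then skip else addAmount)
      { s with inp := .var :: rest
               out := List.replicate i .succ ++ s.out
               dep := List.replicate (d - i) .tick
               aux := List.replicate (min i d + 0) .tick } (5 * n + 3)
      { s with inp := .var :: rest
               out := List.replicate (if i < d then 0 else n) .succ ++
                 (List.replicate i .succ ++ s.out)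
               dep := List.replicate (d - i) .tick
               aux := List.replicate (min i d + 0) .tick } := by
    refine runs_onTop ?_
    change Runs (bif (List.replicate (d - i) Sym.tick).head?.isSome then _ else _) _ _ _
    rw [h2]
    by_cases hid : i < d
    · simp only [hid, decide_true]
      exact (runs_skip _).to (by simp) (by omega)
    · simp only [hid, decide_false]
      exact runs_addAmount n _ hn hs
  refine Runs.to (Runs.seq h1 (Runs.seq h3 (Runs.seq (runs_move rfl) (runs_moveAll _ ?_)))) ?_ ?_
  · decide
  · obtain ⟨⟩ := s
    cases hn
    cases hs
    cases hd
    cases ha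
    simp only [Store.set, Store.get, Store.mk.injEq, true_and, and_true]
    constructor
    · by_cases hid : i < d
      · simp [hid, Term.code]
      · simp only [hid, Term.code, Term.shiftUnder_var, if_false]
        rw [← List.append_assoc, List.replicate_append_replicate, Nat.add_comm]
        simp
    · simp
      omega
  · simp [Store.get, Store.set]
    omega

/-- Recursion over the term becomes an agenda on `todo`. The rest of the agenda enters as the
hypothesis `hW` on the remaining run, so that the two subterms of a binary constructor are handled
by nesting the induction hypotheses. The factor `n + 1` pays for the units added at each free index.
-/
theorem runs_transferLoop (t : Term) (d n : ℕ) (s s' : Store tm) (rest Y : List Sym) (N : ℕ)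
    (h : s.inp = t.code ++ rest) (hd : s.dep = List.replicate d .tick)
    (hn : s.amt = List.replicate n .tick) (ha : s.aux = []) (hs : s.sav = [])
    (ht : s.todo = .var :: Y)
    (hW : Runs transferLoop
      { s with inp := rest, todo := Y, out := (t.shiftUnder d n).code.reverse ++ s.out } N s') :
    Runs transferLoop s (N + 30 * (n + 1) * t.code.length) s' := by
  induction t generalizing d s rest Y N with
  | var i =>
    have step : Runs transferStep s (20 * (n + 1) * (i + 1) + 3)
        { s with inp := rest, todo := Y
                 out := ((Term.var i).shiftUnder d n).code.reverse ++ s.out } := by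
      obtain ⟨⟩ := s
      cases h; cases hd; cases hn; cases ha; cases hs; cases ht
      cases i with
      | zero =>
        exact Runs.to (runs_onTop (runs_onTop (Runs.seq (runs_pop _ _)
          (runs_transferVar 0 d n _ rest rfl rfl rfl rfl rfl)))) rfl (by omega)
      | succ i =>
        exact Runs.to (runs_onTop (runs_onTop (Runs.seq (runs_pop _ _)
          (runs_transferVar (i + 1) d n _ rest rfl rfl rfl rfl rfl)))) rfl (by omega)
    refine (runs_whileNonempty_cons (q := .todo) ht step hW).mono ?_
    simp only [Term.code, List.length_append, List.length_replicate, List.length_singleton]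
    nlinarith
  | lam t ih =>
    have step : Runs transferStep s 7
        { s with inp := t.code ++ rest, todo := .var :: .lam :: Y, out := .lam :: s.out
                 dep := List.replicate (d + 1) .tick } := by
      obtain ⟨⟩ := s
      cases h; cases hd; cases hn; cases ha; cases hs; cases ht
      exact Runs.to (runs_onTop (runs_onTop (Runs.seq (runs_move rfl) (Runs.seq (runs_pop _ _)
        (Runs.seq (runs_push _ _ _) (Runs.seq (runs_push _ _ _) (runs_push _ _ _))))))) rfl le_rfl
    -- After the body, the marker `lam` on the agenda removes the tick that this binder put on
    -- `dep`.
    have leave : Runs transferStep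
        { s with inp := rest, todo := .lam :: Y, dep := List.replicate (d + 1) .tick
                 out := (t.shiftUnder (d + 1) n).code.reverse ++ .lam :: s.out } 3
        { s with inp := rest, todo := Y
                 out := ((Term.lam t).shiftUnder d n).code.reverse ++ s.out } := by
      refine Runs.to (runs_onTop (Runs.seq (runs_pop _ _) (runs_pop _ _))) ?_ le_rfl
      simp [Store.set, Store.get, Term.code, hd]
    refine (runs_whileNonempty_cons (q := .todo) ht step (ih (d + 1) _ rest (.lam :: Y) _ rfl rfl hn ha hs rfl
      (runs_whileNonempty_cons rfl leave hW))).mono ?_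
    simp only [Term.code, List.length_cons]
    nlinarith
  | app t u iht ihu =>
    have step : Runs transferStep s 4
        { s with inp := t.code ++ (u.code ++ rest), todo := .var :: .var :: Y
                 out := .app :: s.out } := by
      obtain ⟨⟩ := s
      cases h; cases hd; cases hn; cases ha; cases hs; cases ht
      refine Runs.to (runs_onTop (runs_onTop (Runs.seq (runs_move rfl) (runs_push _ _ _)))) ?_
        le_rfl
      simp [Store.set, Store.get]
    refine (runs_whileNonempty_cons (q := .todo) ht step (iht d _ (u.code ++ rest) (.var :: Y) _ rfl hd hn ha hs
      rfl (ihu d _ rest Y N rfl hd hn ha hs rfl (hW.to_left ?_)))).mono ?_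
    · simp [Term.code]
    · simp only [Term.code, List.length_cons, List.length_append]
      nlinarith
  | es t u iht ihu =>
    -- The old `var` on the agenda stays below the marker: it stands for `u`, which is read after
    -- the binder of `t` has been left.
    have step : Runs transferStep s 6
        { s with inp := t.code ++ (u.code ++ rest), todo := .var :: .lam :: .var :: Y
                 out := .es :: s.out, dep := List.replicate (d + 1) .tick } := by
      obtain ⟨⟩ := s
      cases h; cases hd; cases hn; cases ha; cases hs; cases ht
      refine Runs.to (runs_onTop (runs_onTop (Runs.seq (runs_move rfl) (Runs.seq (runs_push _ _ _)
        (Runs.seq (runs_push _ _ _) (runs_push _ _ _)))))) ?_ le_rfl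
      simp [Store.set, Store.get, List.replicate_succ]
    have leave : Runs transferStep
        { s with inp := u.code ++ rest, todo := .lam :: .var :: Y
                 dep := List.replicate (d + 1) .tick
                 out := (t.shiftUnder (d + 1) n).code.reverse ++ .es :: s.out } 3
        { s with inp := u.code ++ rest, todo := .var :: Y
                 out := (t.shiftUnder (d + 1) n).code.reverse ++ .es :: s.out } := by
      refine Runs.to (runs_onTop (Runs.seq (runs_pop _ _) (runs_pop _ _))) ?_ le_rfl
      simp [Store.set, Store.get, hd]
    refine (runs_whileNonempty_cons (q := .todo) ht step (iht (d + 1) _ (u.code ++ rest) (.lam :: .var :: Y) _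
      rfl rfl hn ha hs rfl (runs_whileNonempty_cons rfl leave
        (ihu d _ rest Y N rfl hd hn ha hs rfl (hW.to_left ?_))))).mono ?_
    · simp [Term.code]
    · simp only [Term.code, List.length_cons, List.length_append]
      nlinarith

theorem runs_transfer (t : Term) (n : ℕ) (s : Store tm) (rest : List Sym)
    (h : s.inp = t.code ++ rest) (hn : s.amt = List.replicate n .tick) (hd : s.dep = [])
    (ha : s.aux = []) (hs : s.sav = []) (ht : s.todo = []) :
    Runs transfer s (30 * (n + 1) * t.code.length + 2)
      { s with inp := rest, out := (t.shift n).code.reverse ++ s.out } := by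
  refine Runs.to (Runs.seq (runs_push _ _ _) (runs_transferLoop t 0 n _ _ rest [] 1 h hd hn ha hs
    (by simp [Store.set, Store.get, ht]) (runs_whileNonempty_nil rfl))) ?_ (by omega)
  simp [Store.set, ht, Term.shiftUnder_zero_left]

end LSC

namespace LSC

open Turing Function Frag

variable {tm : FinTM2}

/-! ### Contexts and paths as strings -/

/-- The part of the code of `C.plug s` before the code of `s`. -/
def Ctx.pre : Ctx → List Sym
  | .hole => []
  | .lam C => .lam :: C.pre
  | .appL C _ => .app :: C.pre
  | .appR t C => .app :: (t.code ++ C.pre)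
  | .es C _ => .es :: C.pre

/-- The part of the code of `C.plug s` after the code of `s`. -/
def Ctx.post : Ctx → List Sym
  | .hole => []
  | .lam C => C.post
  | .appL C t => C.post ++ t.code
  | .appR _ C => C.post
  | .es C t => C.post ++ t.code

theorem Ctx.code_plug (C : Ctx) (s : Term) : (C.plug s).code = C.pre ++ (s.code ++ C.post) := by
  induction C <;> simp_all [Ctx.plug, Ctx.pre, Ctx.post, Term.code]

@[simp] theorem Ctx.pre_comp (C D : Ctx) : (C.comp D).pre = C.pre ++ D.pre := by
  induction C <;> simp_all [Ctx.comp, Ctx.pre]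

@[simp] theorem Ctx.path_comp (C D : Ctx) : (C.comp D).path = C.path ++ D.path := by
  induction C <;> simp_all [Ctx.comp, Ctx.path]

/-- Any injective coding that avoids `tick` would do: `tick` is reserved for the answer that there
is no redex. -/
def Dir.sym : Dir → Sym
  | .lam => .lam
  | .appL => .app
  | .appR => .var
  | .es => .es

/-- The path to the hole on a stack. -/
def Ctx.syms (C : Ctx) : List Sym := C.path.map Dir.sym

/-- In prefix notation a substitution context announces itself only by a block of `es`, one per
binder, so the abstraction under `L` is found by reading past that block. -/
theorem Ctx.pre_toCtx (L : SubstCtx) : L.toCtx.pre = List.replicate L.toCtx.depth .es := by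
  induction L <;> simp_all [SubstCtx.toCtx, Ctx.pre, Ctx.depth, List.replicate_succ]

theorem Ctx.syms_toCtx (L : SubstCtx) : L.toCtx.syms = List.replicate L.toCtx.depth .es := by
  induction L <;>
    simp_all [SubstCtx.toCtx, Ctx.syms, Ctx.path, Ctx.depth, List.replicate_succ, Dir.sym]

/-! ### Contracting a redex -/

namespace Frag

def walkStep : Frag tm :=
  onTop .path fun o =>
    match o with
    | some .var => move .path .rpath ;; move .inp .out ;; transfer
    | _ => move .path .rpath ;; move .inp .out

/-- Follow the path on `path`, moving what precedes its end from `inp` to `out`. -/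
def walk : Frag tm := whileNonempty .path walkStep

def ascendStep : Frag tm :=
  onTop .rpath fun o =>
    match o with
    | some .lam => pop .rpath ;; move .lvl .passed
    | some .app => pop .rpath ;; transfer
    | some .var => pop .rpath
    | _ => onTop .lvl fun a =>
      bif a.isSome then pop .rpath ;; move .lvl .passed ;; transfer else clear .rpath

/-- Go up along `rpath` as long as `lvl` counts binders above, moving what follows the hole from
`inp` to `out`. -/
def ascend : Frag tm := whileNonempty .rpath ascendStep

def prepend (q : Stk) : Frag tm := moveAll q .out ;; moveAll .out .inp

/-- Insert the term on `arg`, shifted by `passed`, between `hold` and `tmp`. -/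
def splice : Frag tm :=
  prepend .tmp ;; prepend .arg ;; moveAll .hold .out ;; moveAll .passed .amt ;; transfer ;;
    clear .amt ;; moveAll .out .inp

def enterSubst : Frag tm :=
  whileTop (.inl .inp) (fun o => o == some .es)
    (move .inp .out ;; push .rpath .es ;; push .lvl .tick)

def contractBeta : Frag tm :=
  clear .rpath ;; pop .inp ;; enterSubst ;; pop .inp ;; push .out .es ;; transfer ;;
    moveAll .out .hold ;; ascend ;; moveAll .out .tmp ;; transfer ;; moveAll .out .arg ;; splice

def readIndex : Frag tm :=
  whileTop (.inl .inp) (fun o => o == some .succ) (pop .inp ;; push .lvl .tick)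

def contractSubst : Frag tm :=
  readIndex ;; pop .inp ;; moveAll .out .hold ;; ascend ;; push .passed .tick ;;
    moveAll .out .tmp ;; transfer ;; duplicate ;; splice

def contract : Frag tm :=
  walk ;; onTop .inp fun o =>
    match o with
    | some .app => contractBeta
    | _ => contractSubst

end Frag

/-- The stores between the phases of the implementation. -/
def Store.base (tm : FinTM2) (inp path cnt : List Sym) : Store tm where
  inp := inp
  out := []
  tmp := []
  arg := []
  hold := []
  amt := []
  sav := []
  dep := []
  aux := []
  todo := []
  path := path
  rpath := []
  lvl := []
  passed := []
  cnt := cnt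
  ext := fun _ => []

theorem runs_transfer_zero (t : Term) (s : Store tm) (rest : List Sym)
    (h : s.inp = t.code ++ rest) (hn : s.amt = []) (hd : s.dep = [])
    (ha : s.aux = []) (hs : s.sav = []) (ht : s.todo = []) :
    Runs transfer s (30 * t.code.length + 2)
      { s with inp := rest, out := t.code.reverse ++ s.out } :=
  (runs_transfer t 0 s rest h hn hd ha hs ht).to
    (by rw [← Term.shiftUnder_zero_left, Term.shiftUnder_zero_right]) (by omega)

/-- Each turn of the path puts a single symbol before the hole, except the right branch of an
application, where the whole left subterm comes first and has to be parsed. -/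
theorem runs_walk (C : Ctx) (s : Store tm) (w : List Sym) (h : s.inp = C.pre ++ w)
    (hp : s.path = C.syms) (hn : s.amt = []) (hd : s.dep = []) (ha : s.aux = [])
    (hs : s.sav = []) (ht : s.todo = []) :
    Runs walk s (30 * C.pre.length + 1)
      { s with inp := w, out := C.pre.reverse ++ s.out, path := []
               rpath := C.syms.reverse ++ s.rpath } := by
  have step : ∀ (a x : Sym) (l m : List Sym) (s : Store tm), s.path = x :: l → x ≠ .var →
      s.inp = a :: m → Runs walkStep s 3
        { s with inp := m, out := a :: s.out, path := l, rpath := x :: s.rpath } := by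
    intro a x l m s hp hx hi
    obtain ⟨⟩ := s
    cases hp
    cases hi
    cases x with
    | var => exact absurd rfl hx
    | _ => exact Runs.to (runs_onTop (Runs.seq (runs_move rfl) (runs_move rfl))) rfl le_rfl
  induction C generalizing s with
  | hole =>
    obtain ⟨⟩ := s
    cases h
    cases hp
    exact (runs_whileNonempty_nil rfl).to rfl le_rfl
  | appR t C ih =>
    have step' : Runs walkStep s (30 * t.code.length + 5)
        { s with inp := C.pre ++ w, out := t.code.reverse ++ .app :: s.out, path := C.syms
                 rpath := .var :: s.rpath } := by
      obtain ⟨⟩ := s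
      cases h; cases hp; cases hn; cases hd; cases ha; cases hs; cases ht
      exact Runs.to (runs_onTop (Runs.seq (runs_move rfl) (Runs.seq (runs_move rfl)
        (runs_transfer_zero t _ _ (List.append_assoc _ _ _) rfl rfl rfl rfl rfl)))) rfl (by omega)
    refine (runs_whileNonempty_cons (q := .path) hp step' (ih _ rfl rfl hn hd ha hs ht)).to ?_ ?_
    · simp [Ctx.pre, Ctx.syms, Ctx.path, Dir.sym]
    · simp [Ctx.pre]
      omega
  | lam C ih | appL C _ ih | es C _ ih =>
    refine (runs_whileNonempty_cons (q := .path) hp (step _ _ _ _ s hp (by simp [Dir.sym]) h)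
      (ih _ rfl rfl hn hd ha hs ht)).to ?_ ?_
    · simp [Ctx.pre, Ctx.syms, Ctx.path, Dir.sym]
    · simp [Ctx.pre]
      omega

/-- The reversed path is read from the hole outwards, so the outermost constructor of `C` comes
last; hence the remaining run is again a hypothesis. The ticks moved from `lvl` to `passed` count
the binders of `C`, which is the shift needed by a term carried under them. -/
theorem runs_ascend (C : Ctx) (s s' : Store tm) (w R : List Sym) (m k N : ℕ)
    (h : s.inp = C.post ++ w) (hR : s.rpath = C.syms.reverse ++ R)
    (hl : s.lvl = List.replicate (C.depth + m) .tick) (hk : s.passed = List.replicate k .tick)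
    (hn : s.amt = []) (hd : s.dep = []) (ha : s.aux = []) (hs : s.sav = []) (ht : s.todo = [])
    (hW : Runs ascend { s with inp := w, out := C.post.reverse ++ s.out, rpath := R
                               lvl := List.replicate m .tick
                               passed := List.replicate (C.depth + k) .tick } N s') :
    Runs ascend s (N + 30 * C.post.length + 10 * C.path.length) s' := by
  induction C generalizing s w R m N with
  | hole =>
    refine (hW.to_left ?_).mono (by omega)
    obtain ⟨⟩ := s
    simp_all [Ctx.post, Ctx.syms, Ctx.path, Ctx.depth]
  | lam C ih =>
    refine (ih s w (.lam :: R) (m + 1) _ h (by simp [hR, Ctx.syms, Ctx.path, Dir.sym])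
      (by rw [hl, Ctx.depth, Nat.add_right_comm, Nat.add_assoc]) hk hn hd ha hs ht
      (runs_whileNonempty_cons (q := .rpath) rfl (runs_onTop (Runs.seq (runs_pop _ _)
        (runs_move rfl))) (hW.to_left ?_))).mono ?_
    · simp [Store.get, Store.set, Ctx.depth, Ctx.post, ← List.replicate_succ]
      omega
    · simp [Ctx.post, Ctx.path]
      omega
  | appL C t ih =>
    refine (ih s (t.code ++ w) (.app :: R) m _ (by simp [h, Ctx.post])
      (by simp [hR, Ctx.syms, Ctx.path, Dir.sym]) hl hk hn hd ha hs ht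
      (runs_whileNonempty_cons (q := .rpath) rfl (runs_onTop (Runs.seq (runs_pop _ _)
        (runs_transfer_zero t _ w rfl hn hd ha hs ht))) (hW.to_left ?_))).mono ?_
    · simp [Store.get, Store.set, Ctx.depth, Ctx.post]
    · simp [Ctx.post, Ctx.path]
      omega
  | appR t C ih =>
    refine (ih s w (.var :: R) m _ h (by simp [hR, Ctx.syms, Ctx.path, Dir.sym])
      hl hk hn hd ha hs ht (runs_whileNonempty_cons (q := .rpath) rfl (runs_onTop (runs_pop _ _))
        (hW.to_left ?_))).mono ?_
    · simp [Store.get, Store.set, Ctx.depth, Ctx.post]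
    · simp [Ctx.post, Ctx.path]
      omega
  | es C t ih =>
    refine (ih s (t.code ++ w) (.es :: R) (m + 1) _ (by simp [h, Ctx.post])
      (by simp [hR, Ctx.syms, Ctx.path, Dir.sym])
      (by rw [hl, Ctx.depth, Nat.add_right_comm, Nat.add_assoc]) hk hn hd ha hs ht
      (runs_whileNonempty_cons (q := .rpath) rfl (runs_onTop (runs_onTop (Runs.seq (runs_pop _ _)
        (Runs.seq (runs_move rfl) (runs_transfer_zero t _ w rfl hn hd ha hs ht)))))
        (hW.to_left ?_))).mono ?_
    · simp [Store.get, Store.set, Ctx.depth, Ctx.post, ← List.replicate_succ]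
      omega
    · simp [Ctx.post, Ctx.path]
      omega

/-- With the input arranged as `u`, `p`, `w` and `h` reversed on the output, one shifting transfer
of `u` followed by one reversal yields the spliced string. -/
theorem runs_splice (u : Term) (n : ℕ) (w p h cnt : List Sym) :
    Runs splice
      { Store.base tm w [] cnt with
        tmp := p, arg := u.code, hold := h, passed := List.replicate n .tick }
      (30 * (n + 1) * u.code.length + 6 * p.length + 6 * u.code.length +
        2 * (u.shift n).code.length + 4 * h.length + 4 * n + 20)
      (Store.base tm (h ++ ((u.shift n).code ++ (p ++ w))) [] cnt) := by
  have h1 : Runs (prepend .tmp)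
      { Store.base tm w [] cnt with
        tmp := p, arg := u.code, hold := h, passed := List.replicate n .tick } (4 * p.length + 2)
      { Store.base tm (p ++ w) [] cnt with
        arg := u.code, hold := h, passed := List.replicate n .tick } := by
    refine Runs.to (Runs.seq (runs_moveAll _ (by decide)) (runs_moveAll _ (by decide))) ?_ ?_
    · simp [Store.get, Store.set, Store.base]
    · simp [Store.get, Store.set, Store.base]
      omega
  have h2 : Runs (prepend .arg)
      { Store.base tm (p ++ w) [] cnt with
        arg := u.code, hold := h, passed := List.replicate n .tick } (4 * u.code.length + 2)
      { Store.base tm (u.code ++ (p ++ w)) [] cnt with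
        hold := h, passed := List.replicate n .tick } := by
    refine Runs.to (Runs.seq (runs_moveAll _ (by decide)) (runs_moveAll _ (by decide))) ?_ ?_
    · simp [Store.get, Store.set, Store.base]
    · simp [Store.get, Store.set, Store.base]
      omega
  have h3 : Runs (moveAll .hold .out)
      { Store.base tm (u.code ++ (p ++ w)) [] cnt with
        hold := h, passed := List.replicate n .tick } (2 * h.length + 1)
      { Store.base tm (u.code ++ (p ++ w)) [] cnt with
        out := h.reverse, passed := List.replicate n .tick } :=
    (runs_moveAll _ (by decide)).to (by simp [Store.get, Store.set, Store.base]) le_rfl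
  have h4 : Runs (moveAll .passed .amt)
      { Store.base tm (u.code ++ (p ++ w)) [] cnt with
        out := h.reverse, passed := List.replicate n .tick } (2 * n + 1)
      { Store.base tm (u.code ++ (p ++ w)) [] cnt with
        out := h.reverse, amt := List.replicate n .tick } :=
    (runs_moveAll _ (by decide)).to (by simp [Store.get, Store.set, Store.base])
      (by simp [Store.get])
  refine Runs.to (Runs.seq h1 (Runs.seq h2 (Runs.seq h3 (Runs.seq h4 (Runs.seq
    (runs_transfer u n _ _ rfl rfl rfl rfl rfl rfl) (Runs.seq (runs_clear _ _)
      (runs_moveAll _ (by decide)))))))) ?_ ?_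
  · simp [Store.get, Store.set, Store.base]
  · simp [Store.get, Store.set]
    omega

theorem runs_enterSubst (L : SubstCtx) (a k : ℕ) (s : Store tm) (w : List Sym)
    (h : s.inp = L.toCtx.pre ++ .lam :: w) (ha : s.rpath = List.replicate a .es)
    (hk : s.lvl = List.replicate k .tick) :
    Runs enterSubst s (4 * L.toCtx.depth + 1)
      { s with inp := .lam :: w, out := L.toCtx.pre ++ s.out
               rpath := List.replicate (L.toCtx.depth + a) .es
               lvl := List.replicate (L.toCtx.depth + k) .tick } := by
  rw [Ctx.pre_toCtx] at h ⊢
  generalize L.toCtx.depth = n at *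
  induction n generalizing s a k with
  | zero =>
    obtain ⟨⟩ := s
    cases h; cases ha; cases hk
    exact (runs_whileTop_false rfl).to (by simp) (by simp)
  | succ n ih =>
    obtain ⟨⟩ := s
    cases h; cases ha; cases hk
    refine Runs.to (runs_whileTop_true rfl (Runs.seq (runs_move rfl) (Runs.seq (runs_push _ _ _)
      (runs_push _ _ _))) (ih (a + 1) (k + 1) _ rfl rfl rfl)) ?_ (by omega)
    simp [Store.set, Store.get, List.replicate_succ']
    omega

/-- The de Bruijn index of the replaced variable is the number of binders between it and its
substitution, so reading it tells how far to ascend. -/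
theorem runs_readIndex (i k : ℕ) (s : Store tm) (w : List Sym)
    (h : s.inp = List.replicate i .succ ++ .var :: w) (hk : s.lvl = List.replicate k .tick) :
    Runs readIndex s (3 * i + 1)
      { s with inp := .var :: w, lvl := List.replicate (i + k) .tick } := by
  induction i generalizing s k with
  | zero =>
    obtain ⟨⟩ := s
    cases h; cases hk
    exact (runs_whileTop_false rfl).to (by simp) (by simp)
  | succ i ih =>
    obtain ⟨⟩ := s
    cases h; cases hk
    refine Runs.to (runs_whileTop_true rfl (Runs.seq (runs_pop _ _) (runs_push _ _ _))
      (ih (k + 1) _ rfl rfl)) ?_ (by omega)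
    simp only [Store.set, Store.get, Store.mk.injEq, List.replicate_inj]
    simp
    omega

theorem Ctx.length_path_le (C : Ctx) : C.path.length ≤ C.pre.length := by
  induction C <;> simp_all [Ctx.path, Ctx.pre]
  omega

/-- On strings, the symbols `app` and `lam` disappear, an `es` is put before `t`, and `u` jumps over
the suffix of `L`, shifted by the binders of `L`. Both lengths are bounded by `l` because shifting
can lengthen `u`. -/
theorem runs_contractBeta (E : Ctx) (L : SubstCtx) (t u : Term) (r cnt : List Sym) (l : ℕ)
    (hl : (Redex.dB E L t u).source.code.length ≤ l)
    (hl' : (Redex.dB E L t u).target.code.length ≤ l) :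
    Runs contractBeta
      { Store.base tm ((Term.app (L.toCtx.plug (.lam t)) u).code ++ E.post) [] cnt with
        out := E.pre.reverse, rpath := r }
      (2 * r.length + 200 * (l + 1) * (l + 1))
      (Store.base tm (Redex.dB E L t u).target.code [] cnt) := by
  have h1 : Runs (pop .inp)
      { Store.base tm ((Term.app (L.toCtx.plug (.lam t)) u).code ++ E.post) [] cnt with
        out := E.pre.reverse } 1
      { Store.base tm (L.toCtx.pre ++ .lam :: (t.code ++ (L.toCtx.post ++ (u.code ++ E.post))))
        [] cnt with out := E.pre.reverse } :=
    (runs_pop _ _).to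
      (by simp [Store.base, Store.set, Store.get, Term.code, Ctx.code_plug]) le_rfl
  have h2 : Runs (moveAll .out .hold)
      { Store.base tm (L.toCtx.post ++ (u.code ++ E.post)) [] cnt with
        out := t.code.reverse ++ .es :: (L.toCtx.pre ++ E.pre.reverse)
        rpath := List.replicate (L.toCtx.depth + 0) .es
        lvl := List.replicate (L.toCtx.depth + 0) .tick }
      (2 * (t.code.length + (L.toCtx.depth + E.pre.length + 1)) + 1)
      { Store.base tm (L.toCtx.post ++ (u.code ++ E.post)) [] cnt with
        hold := E.pre ++ (L.toCtx.pre ++ .es :: t.code)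
        rpath := L.toCtx.syms.reverse ++ []
        lvl := List.replicate (L.toCtx.depth + 0) .tick } := by
    refine (runs_moveAll _ (by decide)).to ?_ ?_
    · simp [Store.base, Store.set, Store.get, Ctx.syms_toCtx, Ctx.pre_toCtx]
    · simp [Store.get, Ctx.pre_toCtx]
  have h3 := runs_ascend L.toCtx
      { Store.base tm (L.toCtx.post ++ (u.code ++ E.post)) [] cnt with
        hold := E.pre ++ (L.toCtx.pre ++ .es :: t.code)
        rpath := L.toCtx.syms.reverse ++ []
        lvl := List.replicate (L.toCtx.depth + 0) .tick } _ (u.code ++ E.post) [] 0 0 1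
      rfl rfl rfl rfl rfl rfl rfl rfl rfl (runs_whileNonempty_nil rfl)
  have h4 : Runs (moveAll .out .tmp)
      { Store.base tm (u.code ++ E.post) [] cnt with
        hold := E.pre ++ (L.toCtx.pre ++ .es :: t.code)
        out := L.toCtx.post.reverse ++ []
        passed := List.replicate (L.toCtx.depth + 0) .tick } (2 * L.toCtx.post.length + 1)
      { Store.base tm (u.code ++ E.post) [] cnt with
        hold := E.pre ++ (L.toCtx.pre ++ .es :: t.code)
        tmp := L.toCtx.post
        passed := List.replicate L.toCtx.depth .tick } :=
    (runs_moveAll _ (by decide)).to (by simp [Store.base, Store.set, Store.get])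
      (by simp [Store.get])
  have h5 : Runs (moveAll .out .arg)
      { Store.base tm E.post [] cnt with
        out := u.code.reverse ++ []
        hold := E.pre ++ (L.toCtx.pre ++ .es :: t.code)
        tmp := L.toCtx.post
        passed := List.replicate L.toCtx.depth .tick } (2 * u.code.length + 1)
      { Store.base tm E.post [] cnt with
        hold := E.pre ++ (L.toCtx.pre ++ .es :: t.code)
        tmp := L.toCtx.post
        arg := u.code
        passed := List.replicate L.toCtx.depth .tick } :=
    (runs_moveAll _ (by decide)).to (by simp [Store.base, Store.set, Store.get])
      (by simp [Store.get])
  refine Runs.to (Runs.seq (runs_clear _ _) (Runs.seq h1 (Runs.seq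
    (runs_enterSubst L 0 0 _ _ rfl rfl rfl) (Runs.seq (runs_pop _ _) (Runs.seq (runs_push _ _ _)
    (Runs.seq (runs_transfer_zero t _ _ rfl rfl rfl rfl rfl rfl) (Runs.seq h2 (Runs.seq h3
    (Runs.seq h4 (Runs.seq (runs_transfer_zero u _ _ rfl rfl rfl rfl rfl rfl) (Runs.seq h5
    (runs_splice u _ _ _ _ _)))))))))))) ?_ ?_
  · simp [Redex.target, Ctx.code_plug, Term.code]
  · have hL := L.toCtx.length_path_le
    simp only [Redex.source, Redex.target, Ctx.code_plug, Term.code, List.length_append,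
      List.length_cons, Ctx.pre_toCtx, List.length_replicate] at hl hl' hL ⊢
    -- The only quadratic cost is that of shifting `u`: the depth plus one, times the length of `u`.
    have := Nat.mul_le_mul (show L.toCtx.depth + 1 ≤ l + 1 by omega)
      (show u.code.length ≤ l by omega)
    simp only [Store.get]
    nlinarith

/-- The ascent collects the suffix of `C` up to the substitution; its content `u` is then kept in
place and also spliced in for the variable. The extra tick on `passed` accounts for the binder of
the substitution itself, which is not among those of `C`. -/
theorem runs_contractSubst (E C : Ctx) (u : Term) (cnt : List Sym) (l : ℕ)
    (hl : (Redex.ls E C u).source.code.length ≤ l)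
    (hl' : (Redex.ls E C u).target.code.length ≤ l) :
    Runs contractSubst
      { Store.base tm ((Term.var C.depth).code ++ (C.post ++ (u.code ++ E.post))) [] cnt with
        out := (E.comp (.es C u)).pre.reverse, rpath := (E.comp (.es C u)).syms.reverse }
      (200 * (l + 1) * (l + 1))
      (Store.base tm (Redex.ls E C u).target.code [] cnt) := by
  have hsyms : (E.comp (.es C u)).syms.reverse = C.syms.reverse ++ (.es :: E.syms.reverse) := by
    simp [Ctx.syms, Ctx.path, Dir.sym]
  have h2 : Runs (moveAll .out .hold)
      { Store.base tm (C.post ++ (u.code ++ E.post)) [] cnt with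
        out := (E.comp (.es C u)).pre.reverse, rpath := (E.comp (.es C u)).syms.reverse
        lvl := List.replicate (C.depth + 0) .tick }
      (2 * (E.comp (.es C u)).pre.reverse.length + 1)
      { Store.base tm (C.post ++ (u.code ++ E.post)) [] cnt with
        hold := (E.comp (.es C u)).pre, rpath := (E.comp (.es C u)).syms.reverse
        lvl := List.replicate (C.depth + 0) .tick } :=
    (runs_moveAll _ (by decide)).to (by simp [Store.base, Store.set, Store.get]) le_rfl
  -- An `es` met with no level left is the substitution sought; discarding the rest of the path
  -- stops the ascent.
  have h0 : Runs ascendStep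
      { Store.base tm (u.code ++ E.post) [] cnt with
        out := C.post.reverse ++ []
        hold := (E.comp (.es C u)).pre, rpath := .es :: E.syms.reverse
        passed := List.replicate (C.depth + 0) .tick } (2 * E.path.length + 5)
      { Store.base tm (u.code ++ E.post) [] cnt with
        out := C.post.reverse ++ []
        hold := (E.comp (.es C u)).pre
        passed := List.replicate (C.depth + 0) .tick } :=
    Runs.to (runs_onTop (runs_onTop (runs_clear _ _))) rfl (by simp [Store.get, Ctx.syms]; omega)
  have h3 := runs_ascend C
      { Store.base tm (C.post ++ (u.code ++ E.post)) [] cnt with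
        hold := (E.comp (.es C u)).pre, rpath := (E.comp (.es C u)).syms.reverse
        lvl := List.replicate (C.depth + 0) .tick } _ (u.code ++ E.post) (.es :: E.syms.reverse)
      0 0 _ rfl hsyms rfl rfl rfl rfl rfl rfl rfl
      (runs_whileNonempty_cons rfl h0 (runs_whileNonempty_nil rfl))
  have h4 : Runs (moveAll .out .tmp)
      { Store.base tm (u.code ++ E.post) [] cnt with
        out := C.post.reverse ++ []
        hold := (E.comp (.es C u)).pre
        passed := .tick :: List.replicate (C.depth + 0) .tick } (2 * C.post.length + 1)
      { Store.base tm (u.code ++ E.post) [] cnt with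
        tmp := C.post
        hold := (E.comp (.es C u)).pre
        passed := List.replicate (C.depth + 1) .tick } :=
    (runs_moveAll _ (by decide)).to (by simp [Store.base, Store.set, Store.get,
      List.replicate_succ]) (by simp [Store.get])
  have h5 : Runs duplicate
      { Store.base tm E.post [] cnt with
        out := u.code.reverse ++ []
        tmp := C.post
        hold := (E.comp (.es C u)).pre
        passed := List.replicate (C.depth + 1) .tick } (6 * u.code.length + 1)
      { Store.base tm (u.code ++ E.post) [] cnt with
        tmp := C.post
        arg := u.code
        hold := (E.comp (.es C u)).pre
        passed := List.replicate (C.depth + 1) .tick } :=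
    (runs_duplicate _).to (by simp [Store.base]) (by simp)
  refine Runs.to (Runs.seq (runs_readIndex C.depth 0 _ _ ?_ rfl) (Runs.seq (runs_pop _ _)
    (Runs.seq h2 (Runs.seq h3 (Runs.seq (runs_push _ _ _) (Runs.seq h4 (Runs.seq
    (runs_transfer_zero u _ _ rfl rfl rfl rfl rfl rfl) (Runs.seq h5
    (runs_splice u _ _ _ _ _))))))))) ?_ ?_
  · exact List.append_assoc _ _ _
  · simp [Redex.target, Ctx.code_plug, Term.code, Ctx.pre]
  · have hC := C.length_path_le
    have hE := E.length_path_le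
    simp only [Redex.source, Redex.target, Ctx.code_plug, Term.code, List.length_append,
      List.length_cons, Ctx.pre_comp, Ctx.pre, List.length_replicate, List.length_nil,
      List.length_reverse]
      at hl hl' hC ⊢
    have := Nat.mul_le_mul (show C.depth + 1 + 1 ≤ l + 1 by omega)
      (show u.code.length ≤ l by omega)
    nlinarith

theorem runs_contract (R : Redex) (cnt : List Sym) (l : ℕ) (hl : R.source.code.length ≤ l)
    (hl' : R.target.code.length ≤ l) :
    Runs contract (Store.base tm R.source.code R.position.syms cnt) (300 * (l + 1) * (l + 1))
      (Store.base tm R.target.code [] cnt) := by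
  cases R with
  | dB E L t u =>
    have h1 := runs_walk (tm := tm) E (Store.base tm (Redex.dB E L t u).source.code E.syms cnt)
      ((Term.app (L.toCtx.plug (.lam t)) u).code ++ E.post) (Ctx.code_plug _ _) rfl rfl rfl rfl
      rfl rfl
    have h2 := runs_contractBeta (tm := tm) E L t u E.syms.reverse cnt l hl hl'
    refine Runs.to (Runs.seq h1 (runs_onTop (h2.to_left ?_))) rfl ?_
    · simp [Store.base]
    · have := E.length_path_le
      simp only [Redex.source, Ctx.code_plug, List.length_append] at hl
      simp [Ctx.syms]
      nlinarith
  | ls E C u =>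
    have h1 := runs_walk (tm := tm) (E.comp (.es C u))
      (Store.base tm (Redex.ls E C u).source.code (E.comp (.es C u)).syms cnt)
      ((Term.var C.depth).code ++ (C.post ++ (u.code ++ E.post)))
      (by simp [Store.base, Redex.source, Ctx.code_plug, Ctx.pre, Term.code]) rfl rfl rfl rfl
      rfl rfl
    have h2 := runs_contractSubst (tm := tm) E C u cnt l hl hl'
    refine Runs.to (Runs.seq h1 (runs_onTop (n := 200 * (l + 1) * (l + 1))
      (s' := Store.base tm (Redex.ls E C u).target.code [] cnt) ?_)) rfl ?_
    -- A variable starts with `var` if its index is zero and with `succ` otherwise; neither is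
    -- `app`, so the kind of redex is recognised from the first symbol.
    · generalize C.depth = d at h2 ⊢
      cases d
      all_goals exact h2.to_left (by simp [Store.base])
    · simp only [Redex.source, Ctx.code_plug, List.length_append, Term.code, List.length_cons] at hl
      simp [Ctx.pre]
      nlinarith

end LSC

namespace LSC

open Turing Function Frag

/-! ### Calling the selection machine -/

/-- A statement of `tm` in the extended machine. -/
def embed (tm : FinTM2) :
    TM2.Stmt tm.Γ tm.Λ tm.σ → TM2.Stmt (Alph tm) tm.Λ (Reg tm)
  | .push k f q => .push (.inr k) (fun v => f v.2) (embed tm q)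
  | .peek k f q => .peek (.inr k) (fun v x => (v.1, f v.2 x)) (embed tm q)
  | .pop k f q => .pop (.inr k) (fun v x => (v.1, f v.2 x)) (embed tm q)
  | .load f q => .load (fun v => (v.1, f v.2)) (embed tm q)
  | .branch f q r => .branch (fun v => f v.2) (embed tm q) (embed tm r)
  | .goto f => .goto fun v => f v.2
  | .halt => .halt

def embedCfg {tm : FinTM2} (s : Store tm) (v : Option Sym) (c : TM2.Cfg tm.Γ tm.Λ tm.σ) :
    TM2.Cfg (Alph tm) tm.Λ (Reg tm) :=
  ⟨c.l, (v, c.var), ({ s with ext := c.stk } : Store tm).stk⟩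

theorem stepAux_embed {tm : FinTM2} (s : Store tm) (v : Option Sym)
    (q : TM2.Stmt tm.Γ tm.Λ tm.σ) (w : tm.σ) (S : ∀ k, List (tm.Γ k)) :
    TM2.stepAux (embed tm q) (v, w) ({ s with ext := S } : Store tm).stk =
      embedCfg s v (TM2.stepAux q w S) := by
  induction q generalizing w S with
  | push k f q ih =>
    simp only [embed, TM2.stepAux, Store.update_inr]
    exact ih _ _
  | peek k f q ih => exact ih _ _
  | pop k f q ih =>
    simp only [embed, TM2.stepAux, Store.update_inr]
    exact ih _ _
  | load f q ih => exact ih _ _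
  | branch f q r ihq ihr =>
    simp only [embed, TM2.stepAux]
    cases f w
    · exact ihr _ _
    · exact ihq _ _
  | goto f => rfl
  | halt => rfl

theorem Steps.map {α β : Type} {f : α → Option α} {g : β → Option β} (e : α → β)
    (he : ∀ a b, f a = some b → g (e a) = some (e b)) {n : ℕ} {a b : α} (h : Steps f n a b) :
    Steps g n (e a) (e b) := by
  induction n generalizing a with
  | zero =>
    cases h
    rfl
  | succ n ih =>
    obtain ⟨c, hc, h⟩ := h.cases_succ
    rw [Nat.add_comm]
    exact (Steps.single (he _ _ hc)).trans (ih h)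

/-- The family of stacks of `tm` of which only `k` is used. -/
def onlyStack (tm : FinTM2) (k : tm.K) (x : List (tm.Γ k)) : ∀ j, List (tm.Γ j) :=
  update (fun _ => []) k x

theorem onlyStack_nil (tm : FinTM2) (k : tm.K) : onlyStack tm k [] = fun _ => [] :=
  update_eq_self k _

theorem initList_stk (tm : FinTM2) (x : List (tm.Γ tm.k₀)) :
    (initList tm x).stk = onlyStack tm tm.k₀ x := by
  funext k
  by_cases h : k = tm.k₀
  · subst h
    simp [initList, onlyStack]
  · simp [initList, onlyStack, h]

theorem haltList_stk (tm : FinTM2) (x : List (tm.Γ tm.k₁)) :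
    (haltList tm x).stk = onlyStack tm tm.k₁ x := by
  funext k
  by_cases h : k = tm.k₁
  · subst h
    simp [haltList, onlyStack]
  · simp [haltList, onlyStack, h]

def Frag.call (tm : FinTM2) : Frag tm :=
  letI := tm.ΛFin
  { Label := tm.Λ, main := tm.main, code := fun l => embed tm (tm.m l) }

/-- The output convention makes `tm` halt in its initial state with all stacks but the output one
empty. Once the answer has been fetched, it is therefore ready for another call. -/
theorem runs_call {tm : FinTM2} (s : Store tm) {x : List (tm.Γ tm.k₀)} {y : List (tm.Γ tm.k₁)}
    {n : ℕ} (h : TM2OutputsInTime tm x (some y) n) :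
    Runs (call tm) { s with ext := onlyStack tm tm.k₀ x } n
      { s with ext := onlyStack tm tm.k₁ y } := by
  intro v
  refine ⟨v, h.steps, h.steps_le_m, ?_⟩
  rw [← initList_stk, ← haltList_stk]
  refine Steps.map (f := tm.step) (a := initList tm x) (b := haltList tm y) (embedCfg s v) ?_
    h.evals_in_steps
  rintro ⟨_ | l, w, S⟩ b hb
  · cases hb
  · cases hb
    exact congrArg some (stepAux_embed s v (tm.m l) w S)

/-! ### The implementation of a strategy -/

/-- The answers of the selection machine, on the stacks of the implementation. -/
def answerSym : Option Dir → Sym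
  | none => .tick
  | some d => d.sym

section

variable (M : TM2ComputableAux Sym (Option Dir))

namespace Frag

def feedStep : Frag M.tm :=
  ofStmt (.pop (.inl .tmp) (fun v x => (x, v.2)) (.push (.inl .inp) (fun v => v.1.getD .tick)
    (.push (.inr M.tm.k₀) (fun v => M.inputAlphabet.symm (v.1.getD .tick)) .halt)))

/-- Copy `inp` to the input stack of the selection machine. -/
def feed : Frag M.tm := moveAll .inp .tmp ;; whileNonempty .tmp (feedStep M)

def fetchStep : Frag M.tm :=
  ofStmt (.pop (.inr M.tm.k₁) (fun v x => (x.map fun a => answerSym (M.outputAlphabet a), v.2))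
    (.push (.inl .rpath) (fun v => v.1.getD .tick) .halt))

/-- Move the answer of the selection machine to `path`. -/
def fetch : Frag M.tm :=
  whileTop (.inr M.tm.k₁) (fun o => o.isSome) (fetchStep M) ;; moveAll .rpath .path

/-- Perform one step of the strategy. -/
def iterate : Frag M.tm :=
  pop .cnt ;; feed M ;; call M.tm ;; fetch M ;; onTop .path fun o =>
    match o with
    -- No redex: emptying the counter ends the main loop with the normal form on `inp`.
    | some .tick => clear .path ;; clear .cnt
    | _ => contract

def loadCount {tm : FinTM2} : Frag tm :=
  whileTop (.inl .inp) (fun o => o == some .tick) (move .inp .cnt)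

/-- A halting configuration must have the initial internal state, whereas `Runs` leaves the register
arbitrary. -/
def reset {tm : FinTM2} : Frag tm := ofStmt (.load (fun v => (none, v.2)) .halt)

def implementation : Frag M.tm := (loadCount ;; whileNonempty .cnt (iterate M)) ;; reset

end Frag

theorem runs_feed (w cnt : List Sym) :
    Runs (feed M) (Store.base M.tm w [] cnt) (4 * w.length + 2)
      { Store.base M.tm w [] cnt with
        ext := onlyStack M.tm M.tm.k₀ (w.map M.inputAlphabet.symm) } := by
  have key : ∀ (l w : List Sym), Runs (whileNonempty .tmp (feedStep M))
      { Store.base M.tm w [] cnt with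
        tmp := l, ext := onlyStack M.tm M.tm.k₀ (w.map M.inputAlphabet.symm) } (2 * l.length + 1)
      { Store.base M.tm (l.reverse ++ w) [] cnt with
        ext := onlyStack M.tm M.tm.k₀ ((l.reverse ++ w).map M.inputAlphabet.symm) } := by
    intro l
    induction l with
    | nil => exact fun w => (runs_whileNonempty_nil rfl).to rfl le_rfl
    | cons x l ih =>
      intro w
      have step : Runs (feedStep M) { Store.base M.tm w [] cnt with
          tmp := x :: l, ext := onlyStack M.tm M.tm.k₀ (w.map M.inputAlphabet.symm) } 1
          { Store.base M.tm (x :: w) [] cnt with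
            tmp := l, ext := onlyStack M.tm M.tm.k₀ ((x :: w).map M.inputAlphabet.symm) } := by
        refine fun v => ⟨some x, 1, le_rfl, Steps.single ?_⟩
        change some (TM2.stepAux _ _ _) = _
        simp only [feedStep, ofStmt, TM2.stepAux, Store.update_inl, Store.update_inr]
        simp [Store.stk, Store.get, Store.set, Store.base, onlyStack]
      refine (runs_whileNonempty_cons (q := .tmp) rfl step (ih (x :: w))).to ?_ ?_
      · simp
      · simp
        omega
  refine Runs.to (Runs.seq (runs_moveAll _ (by decide)) ((key w.reverse []).to_left ?_)) ?_ ?_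
  · simp [Store.set, Store.get, Store.base, onlyStack_nil]
  · simp
  · simp [Store.get, Store.base]
    omega

theorem runs_fetch (w cnt : List Sym) (y : List (Option Dir)) :
    Runs (fetch M)
      { Store.base M.tm w [] cnt with
        ext := onlyStack M.tm M.tm.k₁ (y.map M.outputAlphabet.symm) } (4 * y.length + 2)
      (Store.base M.tm w (y.map answerSym) cnt) := by
  have key : ∀ (y : List (Option Dir)) (r : List Sym),
      Runs (whileTop (.inr M.tm.k₁) (fun o => o.isSome) (fetchStep M))
        { Store.base M.tm w [] cnt with
          rpath := r, ext := onlyStack M.tm M.tm.k₁ (y.map M.outputAlphabet.symm) }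
        (2 * y.length + 1)
        { Store.base M.tm w [] cnt with rpath := (y.map answerSym).reverse ++ r } := by
    intro y
    induction y with
    | nil =>
      refine fun r => (runs_whileTop_false ?_).to ?_ le_rfl
      · simp [Store.stk, onlyStack]
      · simp [Store.base, onlyStack_nil]
    | cons a y ih =>
      intro r
      have step : Runs (fetchStep M) { Store.base M.tm w [] cnt with
          rpath := r, ext := onlyStack M.tm M.tm.k₁ ((a :: y).map M.outputAlphabet.symm) } 1
          { Store.base M.tm w [] cnt with
            rpath := answerSym a :: r
            ext := onlyStack M.tm M.tm.k₁ (y.map M.outputAlphabet.symm) } := by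
        refine fun v => ⟨some (answerSym a), 1, le_rfl, Steps.single ?_⟩
        change some (TM2.stepAux _ _ _) = _
        simp only [fetchStep, ofStmt, TM2.stepAux, Store.update_inl, Store.update_inr]
        simp [Store.stk, Store.get, Store.set, Store.base, onlyStack]
      refine (runs_whileTop_true ?_ step (ih _)).to ?_ ?_
      · simp [Store.stk, onlyStack]
      · simp
      · simp
        omega
  refine Runs.to (Runs.seq ((key y []).to_left rfl) (runs_moveAll _ (by decide))) ?_ ?_
  · simp [Store.set, Store.get, Store.base]
  · simp [Store.get]
    omega

theorem runs_loadCount {tm : FinTM2} (t : Term) (k : ℕ) :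
    Runs loadCount (Store.base tm (inputCode t k) [] []) (2 * k + 1)
      (Store.base tm t.code [] (List.replicate k .tick)) := by
  have key : ∀ j : ℕ, Runs loadCount
      (Store.base tm (inputCode t k) [] (List.replicate j .tick)) (2 * k + 1)
      (Store.base tm t.code [] (List.replicate (k + j) .tick)) := by
    induction k with
    | zero =>
      intro j
      refine (runs_whileTop_false ?_).to (by simp [inputCode]) (by simp)
      -- The code of a term never starts with `tick`, so the unary counter needs no separator.
      change ((inputCode t 0).head? == some Sym.tick) = false
      cases t with
      | var i => cases i <;> rfl
      | _ => rfl
    | succ k ih =>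
      intro j
      refine Runs.to (runs_whileTop_true rfl (runs_move rfl) ((ih (j + 1)).to_left ?_)) ?_ ?_
      · rfl
      · rw [Nat.succ_add_eq_add_succ]
      · omega
  exact key 0

theorem Runs.reset {tm : FinTM2} {F : Frag tm} {s s' : Store tm} {n : ℕ} (h : Runs F s n s')
    (v : Option Sym) : ∃ m ≤ n + 1, Steps (TM2.step (F ;; Frag.reset).code) m
      ⟨some (F ;; Frag.reset).main, (v, tm.initialState), s.stk⟩
      ⟨none, (none, tm.initialState), s'.stk⟩ := by
  obtain ⟨v', i, hi, h⟩ := h v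
  refine ⟨i + 1, by omega, ?_⟩
  exact (h.relabel (m' := (F ;; Frag.reset).code) (e := Sum.inl)
    (next := some (.inr Frag.reset.main)) (fun _ => rfl) rfl (by simp)).trans (Steps.single rfl)

/-- The implementation of the strategy whose redexes are selected by `M`. -/
def implementationMachine : TM2ComputableAux Sym Sym :=
  letI := M.tm.kFin
  letI := M.tm.σFin
  letI := (implementation M).fin
  { tm :=
      { K := Stk ⊕ M.tm.K
        k₀ := .inl .inp
        k₁ := .inl .inp
        Γ := Alph M.tm
        Λ := (implementation M).Label
        main := (implementation M).main
        σ := Reg M.tm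
        initialState := (none, M.tm.initialState)
        Γk₀Fin := inferInstanceAs (Fintype Sym)
        m := (implementation M).code }
    inputAlphabet := Equiv.refl Sym
    outputAlphabet := Equiv.refl Sym }

theorem outputsInTime_implementationMachine {w w' : List Sym} {n : ℕ}
    (h : Runs (loadCount ;; whileNonempty .cnt (iterate M)) (Store.base M.tm w [] []) n
      (Store.base M.tm w' [] [])) :
    OutputsInTime (implementationMachine M) w w' (n + 1) := by
  have hstk : ∀ x : List Sym, (initList (implementationMachine M).tm x).stk =
      (Store.base M.tm x [] []).stk := by
    intro x
    refine (initList_stk (implementationMachine M).tm x).trans ?_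
    funext k
    rcases k with k | k
    · cases k <;> rfl
    · rfl
  -- Input and output stack are the same, so both families of stacks agree by definition.
  have hstk' : ∀ x : List Sym, (haltList (implementationMachine M).tm x).stk =
      (Store.base M.tm x [] []).stk := hstk
  obtain ⟨m, hm, h⟩ := h.reset none
  refine ⟨⟨⟨m, ?_⟩, hm⟩⟩
  have hw : ∀ x : List Sym, x.map (implementationMachine M).inputAlphabet.symm = x := List.map_id
  have hw' : ∀ x : List Sym, x.map (implementationMachine M).outputAlphabet.symm = x :=
    List.map_id
  have hinit : initList (implementationMachine M).tm
      (w.map (implementationMachine M).inputAlphabet.symm) =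
      ⟨some (implementation M).main, (none, M.tm.initialState), (Store.base M.tm w [] []).stk⟩ :=
    (congrArg (initList (implementationMachine M).tm) (hw w)).trans
      (congrArg (TM2.Cfg.mk _ _) (hstk w))
  have hhalt : haltList (implementationMachine M).tm
      (w'.map (implementationMachine M).outputAlphabet.symm) =
      ⟨none, (none, M.tm.initialState), (Store.base M.tm w' [] []).stk⟩ :=
    (congrArg (haltList (implementationMachine M).tm) (hw' w')).trans
      (congrArg (TM2.Cfg.mk _ _) (hstk' w'))
  rw [hinit, Option.map_some, hhalt]
  exact h

theorem Redex.length_path_le (R : Redex) : R.position.path.length ≤ R.source.code.length := by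
  refine (Ctx.length_path_le _).trans ?_
  cases R <;> simp [Redex.position, Redex.source, Ctx.code_plug, Ctx.pre, Term.code]

variable {M}

theorem runs_iterate_none (w cnt : List Sym) {n : ℕ}
    (h : OutputsInTime M w (answerCode none) n) :
    Runs (iterate M) (Store.base M.tm w [] (.tick :: cnt))
      (n + 4 * w.length + 2 * cnt.length + 20) (Store.base M.tm w [] []) := by
  obtain ⟨h⟩ := h
  refine Runs.to (Runs.seq (runs_pop _ _) (Runs.seq ((runs_feed M w cnt).to_left rfl)
    (Runs.seq (runs_call (Store.base M.tm w [] cnt) h) (Runs.seq (runs_fetch M w cnt _)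
      (runs_onTop (Runs.seq (runs_clear _ _) (runs_clear _ _))))))) rfl ?_
  simp [answerCode, Store.set, Store.get, Store.base]
  omega

theorem runs_iterate_some (R : Redex) (cnt : List Sym) {n l : ℕ}
    (h : OutputsInTime M R.source.code (answerCode (some R)) n) (hl : R.source.code.length ≤ l)
    (hl' : R.target.code.length ≤ l) :
    Runs (iterate M) (Store.base M.tm R.source.code [] (.tick :: cnt))
      (n + 8 * l + 300 * (l + 1) * (l + 1) + 20) (Store.base M.tm R.target.code [] cnt) := by
  obtain ⟨h⟩ := h
  have hp : (answerCode (some R)).map answerSym = R.position.syms := by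
    simp only [answerCode, Ctx.syms, List.map_map]
    rfl
  have hR := Redex.length_path_le R
  have hc := runs_contract (tm := M.tm) R cnt l hl hl'
  refine Runs.to (Runs.seq (runs_pop _ _) (Runs.seq ((runs_feed M R.source.code cnt).to_left rfl)
    (Runs.seq (runs_call (Store.base M.tm R.source.code [] cnt) h) (Runs.seq
      (runs_fetch M R.source.code cnt _) (runs_onTop (n := 300 * (l + 1) * (l + 1))
        (s' := Store.base M.tm R.target.code [] cnt) ?_))))) rfl ?_
  · rw [hp]
    change Runs (match R.position.syms.head? with
      | some .tick => clear .path ;; clear .cnt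
      | _ => contract) _ _ _
    have ht : R.position.syms.head? ≠ some .tick := by
      rcases hq : R.position.path with _ | ⟨d, p⟩
      · simp [Ctx.syms, hq]
      · cases d <;> simp [Ctx.syms, hq, Dir.sym]
    split
    · exact absurd ‹_› ht
    · exact hc
  · simp only [answerCode, List.length_map]
    omega

end

/-- The bounds `n`, `l`, `c` on selection time, code length and counter hold for all terms reached,
so each round has the same cost. The counter matters only for the cost of erasing it at a normal
form. -/
theorem runs_loop {X : Strategy} {M : TM2ComputableAux Sym (Option Dir)} {f : Term → ℕ}
    (hM : ∀ u, OutputsInTime M u.code (answerCode (X.next u)) (f u)) {n l c : ℕ} (k : ℕ)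
    (t : Term) (hk : k ≤ c) (hl : ∀ j ≤ k, (X.after j t).code.length ≤ l)
    (hn : ∀ j ≤ k, f (X.after j t) ≤ n) :
    Runs (whileNonempty .cnt (iterate M)) (Store.base M.tm t.code [] (List.replicate k .tick))
      (k * (n + 8 * l + 300 * (l + 1) * (l + 1) + 2 * c + 22) + 1)
      (Store.base M.tm (X.after k t).code [] []) := by
  induction k generalizing t with
  | zero => exact (runs_whileNonempty_nil rfl).to rfl (by simp)
  | succ k ih =>
    have hft : f t ≤ n := hn 0 (by omega)
    have hlt : t.code.length ≤ l := hl 0 (by omega)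
    have hMt := hM t
    cases hX : X.next t with
    | none =>
      rw [hX] at hMt
      refine (runs_whileNonempty_cons (q := .cnt) rfl (runs_iterate_none _ _ hMt)
        (runs_whileNonempty_nil rfl)).to ?_ ?_
      · rw [Strategy.after, hX]
      simp only [List.length_replicate]
      rw [Nat.succ_mul k]
      generalize k * _ = a
      generalize 300 * (l + 1) * (l + 1) = b
      omega
    | some R =>
      obtain rfl := X.source_next t R hX
      have hafter : ∀ j, X.after (j + 1) R.source = X.after j R.target := fun j => by
        rw [Strategy.after, hX]
      rw [hX] at hMt
      refine (runs_whileNonempty_cons (q := .cnt) rfl (runs_iterate_some R _ hMt hlt ?_)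
        (ih R.target (by omega) (fun j hj => ?_) fun j hj => ?_)).to (by rw [hafter]) ?_
      · exact (hafter 0 ▸ hl 1 (by omega) :)
      · exact (hafter j ▸ hl (j + 1) (by omega) :)
      · exact (hafter j ▸ hn (j + 1) (by omega) :)
      · rw [Nat.succ_mul k]
        omega

end LSC

namespace LSC

open Turing Function Frag

/-! ### Size bounds -/

/-- The number of constructors, an index counting as one. -/
def Term.nodes : Term → ℕ
  | .var _ => 1
  | .lam t => t.nodes + 1
  | .app t u => t.nodes + u.nodes + 1
  | .es t u => t.nodes + u.nodes + 1

def Ctx.nodes : Ctx → ℕ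
  | .hole => 0
  | .lam C => C.nodes + 1
  | .appL C t => C.nodes + t.nodes + 1
  | .appR t C => t.nodes + C.nodes + 1
  | .es C t => C.nodes + t.nodes + 1

/-- The free variables of a term have indices less than `n`. -/
def Term.Below : ℕ → Term → Prop
  | n, .var i => i < n
  | n, .lam t => t.Below (n + 1)
  | n, .app t u => t.Below n ∧ u.Below n
  | n, .es t u => t.Below (n + 1) ∧ u.Below n

def Ctx.Below : ℕ → Ctx → Prop
  | _, .hole => True
  | n, .lam C => C.Below (n + 1)
  | n, .appL C t => C.Below n ∧ t.Below n
  | n, .appR t C => t.Below n ∧ C.Below n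
  | n, .es C t => C.Below (n + 1) ∧ t.Below n

-- This invariance is why growth is measured in `nodes`: neither shifting nor the renaming in the
-- subterm property affects it, while both may change code lengths.
@[simp] theorem Term.nodes_rename (ρ : ℕ → ℕ) (t : Term) : (t.rename ρ).nodes = t.nodes := by
  induction t generalizing ρ <;> simp_all [Term.rename, Term.nodes]

@[simp] theorem Term.nodes_shift (n : ℕ) (t : Term) : (t.shift n).nodes = t.nodes :=
  t.nodes_rename _

@[simp] theorem Ctx.nodes_plug (C : Ctx) (t : Term) : (C.plug t).nodes = C.nodes + t.nodes := by
  induction C <;> simp_all [Ctx.plug, Ctx.nodes, Term.nodes] <;> omega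

theorem SubtermUnder.nodes_le {e : ℕ} {s t : Term} (h : SubtermUnder e s t) :
    s.nodes ≤ t.nodes := by
  induction h <;> simp_all [Term.nodes] <;> omega

theorem IsSubterm.nodes_le {d : ℕ} {r t : Term} (h : IsSubterm d r t) : r.nodes ≤ t.nodes := by
  obtain ⟨e, s, ρ, hs, -, -, rfl⟩ := h
  simpa using hs.nodes_le

theorem Term.Below.rename {m n : ℕ} {ρ : ℕ → ℕ} {t : Term} (h : t.Below n)
    (hρ : ∀ i < n, ρ i < m) : (t.rename ρ).Below m := by
  have hlift : ∀ {m n : ℕ} {ρ : ℕ → ℕ}, (∀ i < n, ρ i < m) → ∀ i < n + 1, lift ρ i < m + 1 := by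
    intro m n ρ h i hi
    cases i with
    | zero => simp [lift]
    | succ i => simpa [lift] using h i (by omega)
  induction t generalizing m n ρ with
  | var i => exact hρ i h
  | lam t ih => exact ih h (hlift hρ)
  | app t u iht ihu => exact ⟨iht h.1 hρ, ihu h.2 hρ⟩
  | es t u iht ihu => exact ⟨iht h.1 (hlift hρ), ihu h.2 hρ⟩

theorem Term.Below.shift {m n : ℕ} {t : Term} (h : t.Below m) : (t.shift n).Below (m + n) :=
  h.rename fun i hi => by omega

theorem Ctx.below_plug (C : Ctx) (n : ℕ) (t : Term) :
    (C.plug t).Below n ↔ C.Below n ∧ t.Below (n + C.depth) := by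
  induction C generalizing n <;>
    simp_all [Ctx.plug, Ctx.Below, Term.Below, Ctx.depth, Nat.add_assoc, Nat.add_comm 1] <;> tauto

/-- This is where counting an occurrence of `x_j` as `j + 1` is used: the size then dominates every
free index. -/
theorem Term.below_sizeUnder (d : ℕ) (t : Term) : t.Below (d + t.sizeUnder d) := by
  have mono : ∀ {t : Term} {m n : ℕ}, t.Below m → m ≤ n → t.Below n := by
    intro t
    induction t with
    | var i => exact fun h hmn => lt_of_lt_of_le h hmn
    | lam t ih => exact fun h hmn => ih (m := _ + 1) h (by omega)
    | app t u iht ihu => exact fun h hmn => ⟨iht h.1 hmn, ihu h.2 hmn⟩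
    | es t u iht ihu => exact fun h hmn => ⟨iht (m := _ + 1) h.1 (by omega), ihu h.2 hmn⟩
  induction t generalizing d with
  | var i =>
    simp only [Term.Below, Term.sizeUnder]
    omega
  | lam t ih =>
    exact mono (n := d + t.lam.sizeUnder d + 1) (ih (d + 1)) (by simp only [Term.sizeUnder]; omega)
  | app t u iht ihu =>
    exact ⟨mono (iht d) (by simp only [Term.sizeUnder]; omega),
      mono (ihu d) (by simp only [Term.sizeUnder]; omega)⟩
  | es t u iht ihu =>
    exact ⟨mono (iht (d + 1)) (by simp only [Term.sizeUnder]; omega),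
      mono (ihu d) (by simp only [Term.sizeUnder]; omega)⟩

theorem Term.nodes_le_sizeUnder (d : ℕ) (t : Term) : t.nodes ≤ t.sizeUnder d := by
  induction t generalizing d with
  | var i => simp [Term.nodes, Term.sizeUnder]
  | lam t ih => simpa [Term.nodes, Term.sizeUnder] using ih (d + 1)
  | app t u iht ihu =>
    have := iht d
    have := ihu d
    simp only [Term.nodes, Term.sizeUnder]
    omega
  | es t u iht ihu =>
    have := iht (d + 1)
    have := ihu d
    simp only [Term.nodes, Term.sizeUnder]
    omega

/-- An index is smaller than `n` plus the number of binders above it, and there are at most `nodes`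
of those; so each node costs at most `n + nodes` symbols. -/
theorem Term.Below.length_code_le {n : ℕ} {t : Term} (h : t.Below n) :
    t.code.length ≤ t.nodes * (n + t.nodes) := by
  induction t generalizing n with
  | var i =>
    simp only [Term.Below, Term.code, Term.nodes, List.length_append, List.length_replicate,
      List.length_singleton] at h ⊢
    omega
  | lam t ih =>
    have := ih h
    simp only [Term.code, Term.nodes, List.length_cons]
    nlinarith
  | app t u iht ihu =>
    have := iht h.1
    have := ihu h.2
    simp only [Term.code, Term.nodes, List.length_cons, List.length_append]
    nlinarith [Nat.zero_le (t.nodes * u.nodes)]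
  | es t u iht ihu =>
    have := iht h.1
    have := ihu h.2
    simp only [Term.code, Term.nodes, List.length_cons, List.length_append]
    nlinarith [Nat.zero_le (t.nodes * u.nodes)]

theorem Term.Below.sizeUnder_le {n d : ℕ} {t : Term} (h : t.Below (d + n)) :
    t.sizeUnder d ≤ t.nodes * (n + 1) := by
  induction t generalizing d with
  | var i =>
    simp only [Term.Below, Term.sizeUnder, Term.nodes] at h ⊢
    omega
  | lam t ih =>
    have := ih (d := d + 1) (by rw [Nat.add_right_comm]; exact h)
    simp only [Term.sizeUnder, Term.nodes]
    nlinarith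
  | app t u iht ihu =>
    have := iht h.1
    have := ihu h.2
    simp only [Term.sizeUnder, Term.nodes]
    nlinarith
  | es t u iht ihu =>
    have := iht (d := d + 1) (by rw [Nat.add_right_comm]; exact h.1)
    have := ihu h.2
    simp only [Term.sizeUnder, Term.nodes]
    nlinarith

/-- The shift applied to `u` equals the number of binders it is moved under, so its free variables
keep their identity. -/
theorem Redex.below_target {n : ℕ} {R : Redex} (h : R.source.Below n) : R.target.Below n := by
  cases R with
  | dB E L t u =>
    simp only [Redex.source, Redex.target, Ctx.below_plug, Term.Below] at h ⊢
    obtain ⟨hE, ⟨hL, ht⟩, hu⟩ := h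
    exact ⟨hE, hL, ht, hu.shift⟩
  | ls E C u =>
    simp only [Redex.source, Redex.target, Ctx.below_plug, Term.Below] at h ⊢
    obtain ⟨hE, ⟨hC, -⟩, hu⟩ := h
    refine ⟨hE, ⟨hC, ?_⟩, hu⟩
    have := hu.shift (n := C.depth + 1)
    rwa [show n + E.depth + (C.depth + 1) = n + E.depth + 1 + C.depth by omega] at this

theorem Strategy.below_after (X : Strategy) {n : ℕ} (k : ℕ) {t : Term} (h : t.Below n) :
    (X.after k t).Below n := by
  induction k generalizing t with
  | zero => exact h
  | succ k ih =>
    cases hX : X.next t with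
    | none => simpa [Strategy.after, hX] using h
    | some R =>
      simp only [Strategy.after, hX]
      refine ih (Redex.below_target ?_)
      rwa [X.source_next t R hX]

/-- The induction moves `u` along the derivation but keeps its origin `t` fixed: duplicated terms
are compared with `t`, not with the growing `u`, which makes the growth linear rather than
exponential. -/
theorem Strategy.SubtermProperty.nodes_after_le {X : Strategy} (hX : X.SubtermProperty)
    {t u : Term} (k : ℕ) (h : Relation.ReflTransGen X.Step t u) :
    (X.after k u).nodes ≤ u.nodes + k * t.nodes := by
  induction k generalizing u with
  | zero => simp [Strategy.after]
  | succ k ih =>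
    cases hR : X.next u with
    | none => simp [Strategy.after, hR]
    | some R =>
      simp only [Strategy.after, hR]
      refine (ih (h.tail ⟨R, hR, rfl⟩)).trans ?_
      have hs := X.source_next u R hR
      have key : R.target.nodes ≤ u.nodes + t.nodes := by
        cases R with
        | dB E L s r =>
          rw [← hs]
          simp only [Redex.source, Redex.target, Ctx.nodes_plug, Term.nodes, Term.nodes_shift]
          omega
        | ls E C r =>
          have := (hX t u E C r h hR).nodes_le
          rw [← hs]
          simp only [Redex.source, Redex.target, Ctx.nodes_plug, Term.nodes, Term.nodes_shift]
          omega
      rw [Nat.succ_mul]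
      omega

theorem Strategy.SubtermProperty.nodes_after_le_size {X : Strategy} (hX : X.SubtermProperty)
    (t : Term) {j k : ℕ} (hj : j ≤ k) : (X.after j t).nodes ≤ (k + 1) * t.size := by
  have h1 := hX.nodes_after_le j (Relation.ReflTransGen.refl (a := t))
  have h2 : t.nodes ≤ t.size := t.nodes_le_sizeUnder 0
  nlinarith [Nat.mul_le_mul hj h2]

theorem Term.below_size (t : Term) : t.Below t.size := by
  simpa [Term.size] using t.below_sizeUnder 0

theorem eval_mono (p : Polynomial ℕ) {m n : ℕ} (h : m ≤ n) : p.eval m ≤ p.eval n := by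
  simp only [Polynomial.eval_eq_sum_range]
  gcongr

end LSC

/-! ### The final polynomial. -/

theorem mainTheorem11 (X : LSC.Strategy) (hX : X.Mechanisable) :
    ∃ (M : Turing.TM2ComputableAux LSC.Sym LSC.Sym) (p : MvPolynomial (Fin 2) ℕ),
      ∀ (t : LSC.Term) (k : ℕ),
        LSC.OutputsInTime M (LSC.inputCode t k) (X.after k t).code
          (MvPolynomial.eval ![k, t.size] p) := by
  obtain ⟨M, p, hM⟩ := hX.selection
  -- With `X 0` for `k` and `X 1` for `|t|`, `N` bounds the number of constructors of all terms
  -- reached, `l` their code lengths, and `q` the selection time at the size bound `N * (|t| + 1)`.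
  let N : MvPolynomial (Fin 2) ℕ := (.X 0 + 1) * .X 1
  let l : MvPolynomial (Fin 2) ℕ := N * (.X 1 + N)
  let q : MvPolynomial (Fin 2) ℕ := Polynomial.aeval (N * (.X 1 + 1)) p
  refine ⟨LSC.implementationMachine M,
    2 * .X 0 + 1 + (.X 0 * (q + 8 * l + 300 * (l + 1) * (l + 1) + 2 * .X 0 + 22) + 1) + 1, ?_⟩
  intro t k
  have hnodes : ∀ j ≤ k, (X.after j t).nodes ≤ (k + 1) * t.size :=
    fun j hj => hX.subterm.nodes_after_le_size t hj
  have hbelow : ∀ j, (X.after j t).Below t.size := fun j => X.below_after j (LSC.Term.below_size t)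
  have hcode : ∀ j ≤ k, (X.after j t).code.length ≤
      (k + 1) * t.size * (t.size + (k + 1) * t.size) := fun j hj =>
    (hbelow j).length_code_le.trans
      (Nat.mul_le_mul (hnodes j hj) (Nat.add_le_add_left (hnodes j hj) _))
  have hsize : ∀ j ≤ k, p.eval (X.after j t).size ≤
      p.eval ((k + 1) * t.size * (t.size + 1)) := fun j hj =>
    LSC.eval_mono p ((LSC.Term.Below.sizeUnder_le (d := 0) (by simpa using hbelow j)).trans
      (Nat.mul_le_mul_right _ (hnodes j hj)))
  have h := LSC.outputsInTime_implementationMachine M ((LSC.runs_loadCount t k).seq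
    (LSC.runs_loop hM k t le_rfl hcode hsize))
  have hq : MvPolynomial.eval ![k, t.size] q = p.eval ((k + 1) * t.size * (t.size + 1)) := by
    simp only [q, N, Polynomial.aeval_def, Polynomial.hom_eval₂]
    simp [Polynomial.eval₂_eq_sum_range, Polynomial.eval_eq_sum_range]
  convert h using 1
  simp [hq, l, N]
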